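/- **Theorem 1 (weighted improved Hardy inequality).** Let $N\ge 2$, let $\Omega\subset\mathbb R^N$ be a domain (open and connected) and let $K\subset\mathbb R^N$ be a nonempty closed set; put $d(x)=\operatorname{dist}(x,K)$ and assume $\sup_{\Omega} d<\infty$. Let $p>1$, $s\in\mathbb R$ and $k\in\mathbb R$ with $p\ne k+s$, put $H=(k+s-p)/p$, and suppose that $$(k+s-p)\,(d\,\Delta d-k+1)\ \ge\ 0\quad\text{in the sense of distributions in }\Omega\setminus K .$$ (The main case: $K$ is a piecewise smooth surface of codimension $k\in\{1,\dots,N\}$, with $K=\partial\Omega$ if $k=1$ and $K$ a finite set of points if $k=N$.) For $t\in(0,1]$ define $X_1(t)=(1-\log t)^{-1}$ and $X_i(t)=X_1(X_{i-1}(t))$ for $i\ge 2$. For $m\in\{1,2,3,\dots\}\cup\{\infty\}$ put $$\eta_m(t)=\sum_{i=1}^m X_1(t)\cdots X_i(t),\qquad \zeta_m(t)=\sum_{i=1}^m X_1^2(t)\cdots X_i^2(t).$$ Fix such an $m$ and $\alpha,\beta,\gamma\in\mathbb R$. Then there is a constant $D_0>0$ with $D_0\ge\sup_{\Omega}d$ such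 that, for every $D\ge D_0$, the following holds with $\eta_m=\eta_m(d(x)/D)$ and $\zeta_m=\zeta_m(d(x)/D)$. On $\Omega\setminus K$ the series defining $\eta_\infty(d(x)/D)$ and $\zeta_\infty(d(x)/D)$ converge and $1+\alpha\eta_m+\beta\eta_m^2+\gamma\zeta_m>0$; and for every real-valued $u\in C_c^\infty(\Omega\setminus K)$ all the integrals below converge and $$\begin{aligned}\int_\Omega d^{s}\,(1+\alpha\eta_m+\beta\eta_m^2+\gamma\zeta_m)\,|\nabla u|^p\,dx\ \ge\ {}& |H|^p\int_\Omega d^{s-p}|u|^p\,dx+|H|^p\alpha\int_\Omega d^{s-p}\eta_m|u|^p\,dx\\ &+\Bigl(|H|^p\beta+\frac{|H|^{p-2}H\alpha}{2}\Bigr)\int_\Omega d^{s-p}\eta_m^2|u|^p\,dx\\ &+\Bigl(\frac{p-1}{2p}|H|^{p-2}+\frac{|H|^{p-2}H\alpha}{2}+|H|^p\gamma\Bigr)\int_\Omega d^{s-p}\zeta_m|u|^p\,dx .\end{aligned}$$ -/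

import Mathlib

open MeasureTheory
open scoped ContDiff

namespace WeightedHardy

/-- The iterated logarithmic functions `X i`, meant for arguments in `(0, 1]`:
`X 1 t = (1 - log t)⁻¹` and `X (i + 1) t = X 1 (X i t)`; the auxiliary `X 0` is the identity. -/
noncomputable def X : ℕ → ℝ → ℝ
  | 0, t => t
  | i + 1, t => (1 - Real.log (X i t))⁻¹

/-- The product `X 1 t * ⋯ * X i t`. -/
noncomputable def prodX (i : ℕ) (t : ℝ) : ℝ :=
  ∏ j ∈ Finset.Icc 1 i, X j t

/-- `eta m t = ∑_{i=1}^m X 1 t * ⋯ * X i t`, where `m` may be infinite. -/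
noncomputable def eta : ℕ∞ → ℝ → ℝ
  | (n : ℕ), t => ∑ i ∈ Finset.Icc 1 n, prodX i t
  | ⊤, t => ∑' i : ℕ, prodX (i + 1) t

/-- `zeta m t = ∑_{i=1}^m (X 1 t)^2 * ⋯ * (X i t)^2`, where `m` may be infinite. -/
noncomputable def zeta : ℕ∞ → ℝ → ℝ
  | (n : ℕ), t => ∑ i ∈ Finset.Icc 1 n, prodX i t ^ 2
  | ⊤, t => ∑' i : ℕ, prodX (i + 1) t ^ 2

/-- `u ∈ C_c^∞(U)`, for a real-valued function `u`, extended by zero to the whole space. -/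
structure IsTestFunction {N : ℕ} (U : Set (EuclideanSpace ℝ (Fin N)))
    (u : EuclideanSpace ℝ (Fin N) → ℝ) : Prop where
  contDiff : ContDiff ℝ ∞ u
  hasCompactSupport : HasCompactSupport u
  tsupport_subset : tsupport u ⊆ U

/-- The value of the distribution `d Δd` at the test function `φ`, for `d` locally Lipschitz
on the open set `U` (so that `d` is differentiable almost everywhere and its pointwise gradient
is its weak gradient): `⟨d Δd, φ⟩ = ⟨Δd, d φ⟩ = - ∫_U ∇d · ∇(d φ)`. -/
noncomputable def mulLaplacian {N : ℕ} (U : Set (EuclideanSpace ℝ (Fin N)))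
    (d φ : EuclideanSpace ℝ (Fin N) → ℝ) : ℝ :=
  -∫ x in U, inner ℝ (gradient d x) (gradient (fun y => d y * φ y) x)

/-- The inequality `c (d Δd - k + 1) ≥ 0` in the sense of distributions in the open set `U`. -/
def DistribIneq {N : ℕ} (U : Set (EuclideanSpace ℝ (Fin N)))
    (d : EuclideanSpace ℝ (Fin N) → ℝ) (c k : ℝ) : Prop :=
  ∀ φ : EuclideanSpace ℝ (Fin N) → ℝ, IsTestFunction U φ → (∀ x, 0 ≤ φ x) →
    0 ≤ c * (mulLaplacian U d φ - k * (∫ x in U, φ x) + ∫ x in U, φ x)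

/-- The weight `1 + α η_m + β η_m^2 + γ ζ_m`, as a function of `t`. -/
noncomputable def weight (m : ℕ∞) (α β γ t : ℝ) : ℝ :=
  1 + α * eta m t + β * eta m t ^ 2 + γ * zeta m t

end WeightedHardy

/-! The proof is the vector field method. Write `t = d / D`, `η = η_m(t)`, `ζ = ζ_m(t)`, let `W` be the
weight, and take `T = |H| ^ (p - 2) * H * d ^ (s + 1 - p) * f * ∇d` with `f = 1 + a η + b η ^ 2`.
Integrating `div T * |u| ^ p` by parts and applying Young's inequality gives

  `∫ d ^ s W |∇u| ^ p ≥ ∫ (div T - (p - 1) |T| ^ (p / (p - 1)) (d ^ s W) ^ (-1 / (p - 1))) |u| ^ p`.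

Since `|∇d| = 1` (`norm_gradient_infDist`) and `H (d Δd - k + 1) ≥ 0`, the divergence is bounded below
by `|H| ^ (p - 2) * H * d ^ (s - p) * (p H f + t f')`. Everything is then a polynomial expression in `η`
and `ζ`, thanks to the identity `t η' = (η ^ 2 + ζ) / 2` (`hasDerivAt_eta`), and the theorem is reduced
to an inequality between real numbers (`exists_pointwise_ineq`). With `a = α + (p - 1) / (p H)` its
two sides agree up to second order in `η`, while the third-order remainder is controlled by the term
`b η ζ / H`: here `b` is a large multiple of `H`, and `ζ ≥ η ^ 2 / 16` near the origin
(`eta_sq_le_zeta`). The remaining orders are absorbed by taking `D` large, as `η ≤ 2 / (-log t)`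
uniformly in `m` (`eta_le`), a bound which also yields the convergence of the series.

Formally, `div T` is never formed: the distributional inequality is tested against
`φ = d ^ (s - p) f |u| ^ p` (`DistribIneq.integral_comp_mul`). This `φ` is only Lipschitz, because `d`
is, so the inequality is first extended from smooth to Lipschitz test functions by mollification
(`DistribIneq.lipschitz`), using that the derivative of a mollified Lipschitz function is the
mollification of its almost-everywhere derivative and converges to it at almost every point. -/

namespace WeightedHardy

open Filter Metric Set
open scoped Topology NNReal Convolution
open ContinuousLinearMap (lsmul)

/-! ### The functions `X i`, `η` and `ζ`: bounds -/

theorem X_mem_Ioc (i : ℕ) {t : ℝ} (ht : t ∈ Ioc 0 1) : X i t ∈ Ioc 0 1 := by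
  induction i with
  | zero => exact ht
  | succ i ih =>
    have := Real.log_nonpos ih.1.le ih.2
    exact ⟨inv_pos.2 (by linarith), inv_le_one_of_one_le₀ (by linarith)⟩

theorem X_succ_eq_comp (i : ℕ) (t : ℝ) : X (i + 1) t = X i (X 1 t) := by
  induction i with
  | zero => rfl
  | succ i ih => rw [X, ih]; rfl

theorem prodX_succ (i : ℕ) (t : ℝ) : prodX (i + 1) t = prodX i t * X (i + 1) t :=
  Finset.prod_Icc_succ_top (by omega) _

theorem prodX_succ_eq_mul_comp (i : ℕ) (t : ℝ) : prodX (i + 1) t = X 1 t * prodX i (X 1 t) := by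
  induction i with
  | zero => simp [prodX]
  | succ i ih => rw [prodX_succ, ih, prodX_succ, X_succ_eq_comp (i + 1)]; ring

theorem prodX_pos (i : ℕ) {t : ℝ} (ht : t ∈ Ioc 0 1) : 0 < prodX i t :=
  Finset.prod_pos fun j _ => (X_mem_Ioc j ht).1

theorem eta_succ (n : ℕ) (t : ℝ) : eta ((n + 1 : ℕ) : ℕ∞) t = eta n t + prodX (n + 1) t :=
  Finset.sum_Icc_succ_top (by omega) _

theorem zeta_succ (n : ℕ) (t : ℝ) :
    zeta ((n + 1 : ℕ) : ℕ∞) t = zeta n t + prodX (n + 1) t ^ 2 :=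
  Finset.sum_Icc_succ_top (by omega) _

@[simp] theorem eta_zero (t : ℝ) : eta 0 t = 0 := by
  change ∑ i ∈ Finset.Icc 1 0, prodX i t = 0
  simp

@[simp] theorem zeta_zero (t : ℝ) : zeta 0 t = 0 := by
  change ∑ i ∈ Finset.Icc 1 0, prodX i t ^ 2 = 0
  simp

theorem eta_natCast (n : ℕ) (t : ℝ) : eta n t = ∑ i ∈ Finset.range n, prodX (i + 1) t := by
  induction n with
  | zero => simp
  | succ n ih => rw [eta_succ, ih, Finset.sum_range_succ]

theorem zeta_natCast (n : ℕ) (t : ℝ) : zeta n t = ∑ i ∈ Finset.range n, prodX (i + 1) t ^ 2 := by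
  induction n with
  | zero => simp
  | succ n ih => rw [zeta_succ, ih, Finset.sum_range_succ]

theorem eta_nat_nonneg (n : ℕ) {t : ℝ} (ht : t ∈ Ioc 0 1) : 0 ≤ eta n t := by
  rw [eta_natCast]
  exact Finset.sum_nonneg fun i _ => (prodX_pos _ ht).le

theorem eta_succ_eq_mul_comp (n : ℕ) (t : ℝ) :
    eta ((n + 1 : ℕ) : ℕ∞) t = X 1 t * (1 + eta n (X 1 t)) := by
  rw [eta_natCast, eta_natCast, Finset.sum_range_succ', mul_add, Finset.mul_sum, add_comm]
  refine congrArg₂ _ (by simp [prodX]) (Finset.sum_congr rfl fun i _ => ?_)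
  exact prodX_succ_eq_mul_comp _ _

/-- A bound on the partial sums that does not depend on their length. It is stable under
`t ↦ X 1 t`, because `2 * L / (L + 2) ≤ log (1 + L)` for `L = -log t`. -/
theorem eta_nat_le (n : ℕ) {t : ℝ} (ht : t ∈ Ioo 0 1) : eta n t ≤ 2 / (-Real.log t) := by
  induction n generalizing t with
  | zero =>
    have := Real.log_neg ht.1 ht.2
    simp only [Nat.cast_zero, eta_zero]
    exact div_nonneg (by norm_num) (by linarith)
  | succ n ih =>
    have hL : 0 < -Real.log t := neg_pos.2 (Real.log_neg ht.1 ht.2)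
    have hX : X 1 t = (1 + -Real.log t)⁻¹ := by simp [X, sub_eq_add_neg]
    set L := -Real.log t
    have h1 : X 1 t ∈ Ioo 0 1 := by
      rw [hX]; exact ⟨by positivity, inv_lt_one_of_one_lt₀ (by linarith)⟩
    have h2 := ih h1
    have h3 : -Real.log (X 1 t) = Real.log (1 + L) := by rw [hX, Real.log_inv, neg_neg]
    have h4 := Real.le_log_one_add_of_nonneg hL.le
    have h5 : 2 / Real.log (1 + L) ≤ 1 + 2 / L := by
      calc 2 / Real.log (1 + L) ≤ 2 / (2 * L / (L + 2)) := by gcongr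
        _ = 1 + 2 / L := by field_simp
    rw [h3] at h2
    rw [eta_succ_eq_mul_comp, hX] at *
    calc (1 + L)⁻¹ * (1 + eta n (1 + L)⁻¹) ≤ (1 + L)⁻¹ * (1 + (1 + 2 / L)) := by
          gcongr; linarith
      _ = 2 / L := by field_simp; ring

theorem summable_prodX {t : ℝ} (ht : t ∈ Ioo 0 1) : Summable fun i : ℕ => prodX (i + 1) t := by
  have ht' : t ∈ Ioc 0 1 := ⟨ht.1, ht.2.le⟩
  refine summable_of_sum_range_le (c := 2 / (-Real.log t)) (fun i => (prodX_pos _ ht').le) fun n => ?_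
  rw [← eta_natCast]
  exact eta_nat_le n ht

theorem prodX_le_one (i : ℕ) {t : ℝ} (ht : t ∈ Ioc 0 1) : prodX i t ≤ 1 :=
  Finset.prod_le_one (fun j _ => (X_mem_Ioc j ht).1.le) fun j _ => (X_mem_Ioc j ht).2

theorem summable_prodX_sq {t : ℝ} (ht : t ∈ Ioo 0 1) :
    Summable fun i : ℕ => prodX (i + 1) t ^ 2 := by
  have ht' : t ∈ Ioc 0 1 := ⟨ht.1, ht.2.le⟩
  refine (summable_prodX ht).of_nonneg_of_le (fun i => by positivity) fun i => ?_
  have := prodX_pos (i + 1) ht'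
  nlinarith [prodX_le_one (i + 1) ht']

theorem tendsto_eta_top {t : ℝ} (ht : t ∈ Ioo 0 1) :
    Tendsto (fun n : ℕ => eta n t) atTop (𝓝 (eta ⊤ t)) := by
  simp only [eta_natCast]
  exact (summable_prodX ht).hasSum.tendsto_sum_nat

theorem tendsto_zeta_top {t : ℝ} (ht : t ∈ Ioo 0 1) :
    Tendsto (fun n : ℕ => zeta n t) atTop (𝓝 (zeta ⊤ t)) := by
  simp only [zeta_natCast]
  exact (summable_prodX_sq ht).hasSum.tendsto_sum_nat

theorem eta_le (m : ℕ∞) {t : ℝ} (ht : t ∈ Ioo 0 1) : eta m t ≤ 2 / (-Real.log t) := by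
  induction m using ENat.recTopCoe with
  | top => exact le_of_tendsto' (tendsto_eta_top ht) fun n => eta_nat_le n ht
  | coe n => exact eta_nat_le n ht

theorem zeta_nat_le_eta_sq (n : ℕ) {t : ℝ} (ht : t ∈ Ioc 0 1) : zeta n t ≤ eta n t ^ 2 := by
  induction n with
  | zero => simp
  | succ n ih =>
    rw [eta_succ, zeta_succ]
    nlinarith [eta_nat_nonneg n ht, prodX_pos (n + 1) ht,
      mul_nonneg (eta_nat_nonneg n ht) (prodX_pos (n + 1) ht).le]

theorem zeta_le_eta_sq (m : ℕ∞) {t : ℝ} (ht : t ∈ Ioo 0 1) : zeta m t ≤ eta m t ^ 2 := by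
  induction m using ENat.recTopCoe with
  | top =>
    exact le_of_tendsto_of_tendsto' (tendsto_zeta_top ht) ((tendsto_eta_top ht).pow 2) fun n => zeta_nat_le_eta_sq n ⟨ht.1, ht.2.le⟩
  | coe n => exact zeta_nat_le_eta_sq n ⟨ht.1, ht.2.le⟩

theorem X_one_sq_le_zeta {m : ℕ∞} (hm : 1 ≤ m) {t : ℝ} (ht : t ∈ Ioo 0 1) :
    X 1 t ^ 2 ≤ zeta m t := by
  have h : prodX (0 + 1) t = X 1 t := by simp [prodX]
  rw [← h]
  induction m using ENat.recTopCoe with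
  | top => exact (summable_prodX_sq ht).le_tsum 0 fun i _ => by positivity
  | coe n =>
    rw [zeta_natCast]
    exact Finset.single_le_sum (f := fun i => prodX (i + 1) t ^ 2) (fun i _ => by positivity)
      (Finset.mem_range.2 (by exact_mod_cast hm))

theorem eta_pos {m : ℕ∞} (hm : 1 ≤ m) {t : ℝ} (ht : t ∈ Ioo 0 1) : 0 < eta m t := by
  have ht' : t ∈ Ioc 0 1 := ⟨ht.1, ht.2.le⟩
  have h : 0 < prodX (0 + 1) t := prodX_pos _ ht'
  refine h.trans_le ?_
  induction m using ENat.recTopCoe with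
  | top => exact (summable_prodX ht).le_tsum 0 fun i _ => (prodX_pos _ ht').le
  | coe n =>
    rw [eta_natCast]
    exact Finset.single_le_sum (f := fun i => prodX (i + 1) t) (fun i _ => (prodX_pos _ ht').le)
      (Finset.mem_range.2 (by exact_mod_cast hm))

/-- Near the origin `η` is comparable to its first term `X 1`, hence `η ^ 2` to `ζ`. -/
theorem eta_sq_le_zeta {m : ℕ∞} (hm : 1 ≤ m) {t : ℝ} (ht : t ∈ Ioc 0 (Real.exp (-1))) :
    eta m t ^ 2 / 16 ≤ zeta m t := by
  have h1 : Real.exp (-1) < 1 := Real.exp_lt_one_iff.2 (by norm_num)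
  have ht' : t ∈ Ioo 0 1 := ⟨ht.1, ht.2.trans_lt h1⟩
  have hL : Real.log t ≤ -1 := by simpa using Real.log_le_log ht.1 ht.2
  have h2 : eta m t ≤ 4 * X 1 t := by
    refine (eta_le m ht').trans ?_
    have : X 1 t = (1 + -Real.log t)⁻¹ := by simp [X, sub_eq_add_neg]
    rw [this, ← div_eq_mul_inv, div_le_div_iff₀ (by linarith) (by linarith)]
    linarith
  have h3 := X_one_sq_le_zeta hm ht'
  have h4 := eta_pos hm ht'
  nlinarith

/-- `η` is as small as desired on an interval starting at the origin, uniformly in `m`. -/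
theorem exists_eta_le {ε : ℝ} (hε : 0 < ε) :
    ∃ τ ∈ Ioc (0 : ℝ) (Real.exp (-1)), ∀ m, ∀ t ∈ Ioc 0 τ, eta m t ≤ ε := by
  refine ⟨min (Real.exp (-1)) (Real.exp (-(2 / ε))), ⟨by positivity, min_le_left _ _⟩,
    fun m t ht => ?_⟩
  have h1 : Real.exp (-1) < 1 := Real.exp_lt_one_iff.2 (by norm_num)
  have ht' : t ∈ Ioo 0 1 := ⟨ht.1, (ht.2.trans (min_le_left _ _)).trans_lt h1⟩
  have hL : 2 / ε ≤ -Real.log t := by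
    have := Real.log_le_log ht.1 (ht.2.trans (min_le_right _ _))
    rw [Real.log_exp] at this
    linarith
  refine (eta_le m ht').trans ?_
  calc 2 / (-Real.log t) ≤ 2 / (2 / ε) := by gcongr
    _ = ε := by field_simp

/-! ### Derivatives and continuity of `η` and `ζ` -/

theorem hasDerivAt_X (i : ℕ) {t : ℝ} (ht : t ∈ Ioc 0 1) :
    HasDerivAt (X i) (X i t * prodX i t / t) t := by
  induction i with
  | zero =>
    have : X 0 = id := by funext t; rfl
    have ht0 : t ≠ 0 := ht.1.ne'
    simpa [this, prodX, ht0] using hasDerivAt_id t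
  | succ i ih =>
    have h0 := (X_mem_Ioc i ht).1
    have h1 := Real.log_nonpos h0.le (X_mem_Ioc i ht).2
    have h2 := ((ih.log h0.ne').const_sub 1).fun_inv (by linarith : 1 - Real.log (X i t) ≠ 0)
    refine h2.congr_deriv ?_
    rw [prodX_succ, X]
    have := ht.1.ne'
    have : 1 - Real.log (X i t) ≠ 0 := by linarith
    field_simp

theorem hasDerivAt_prodX (i : ℕ) {t : ℝ} (ht : t ∈ Ioc 0 1) :
    HasDerivAt (prodX i) (prodX i t * eta i t / t) t := by
  induction i with
  | zero =>
    have : prodX 0 = fun _ => 1 := by funext t; simp [prodX]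
    simpa [this, eta] using hasDerivAt_const t (1 : ℝ)
  | succ i ih =>
    have : prodX (i + 1) = fun t => prodX i t * X (i + 1) t := funext (prodX_succ i)
    rw [this]
    refine (ih.fun_mul (hasDerivAt_X (i + 1) ht)).congr_deriv ?_
    rw [eta_succ, prodX_succ]
    ring

theorem hasDerivAt_eta_nat (n : ℕ) {t : ℝ} (ht : t ∈ Ioc 0 1) :
    HasDerivAt (eta n) ((eta n t ^ 2 + zeta n t) / (2 * t)) t := by
  induction n with
  | zero =>
    have : eta 0 = fun _ => 0 := funext eta_zero
    simpa [this] using hasDerivAt_const t (0 : ℝ)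
  | succ n ih =>
    have : eta ((n + 1 : ℕ) : ℕ∞) = fun t => eta n t + prodX (n + 1) t := funext (eta_succ n)
    rw [this]
    refine (ih.fun_add (hasDerivAt_prodX (n + 1) ht)).congr_deriv ?_
    rw [zeta_succ, eta_succ]
    have := ht.1.ne'
    field_simp
    ring

theorem prodX_monotoneOn (i : ℕ) : MonotoneOn (prodX i) (Ioc 0 1) := by
  refine monotoneOn_of_hasDerivWithinAt_nonneg (convex_Ioc 0 1)
    (fun t ht => (hasDerivAt_prodX i ht).continuousAt.continuousWithinAt)
    (fun t ht => (hasDerivAt_prodX i (interior_subset ht)).hasDerivWithinAt) fun t ht => ?_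
  have ht' := interior_subset ht
  have := prodX_pos i ht'
  have := eta_nat_nonneg i ht'
  have := ht'.1
  positivity

/-- The partial sums of the derivatives of the terms of `η` have the closed form
`(η ^ 2 + ζ) / (2 t)`, which is then also the derivative of the infinite series. -/
theorem hasDerivAt_eta_top {t : ℝ} (ht : t ∈ Ioo 0 1) :
    HasDerivAt (eta ⊤) ((eta ⊤ t ^ 2 + zeta ⊤ t) / (2 * t)) t := by
  obtain ⟨b, htb, hb1⟩ := exists_between ht.2
  obtain ⟨a, ha0, hat⟩ := exists_between ht.1
  have hb : b ∈ Ioo 0 1 := ⟨ht.1.trans htb, hb1⟩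
  have hsub : ∀ y ∈ Ioo a b, y ∈ Ioc 0 1 := fun y hy => ⟨ha0.trans hy.1, (hy.2.trans hb1).le⟩
  have key := hasDerivAt_tsum_of_isPreconnected (g := fun i : ℕ => prodX (i + 1))
    (g' := fun i y => prodX (i + 1) y * eta ((i + 1 : ℕ) : ℕ∞) y / y)
    (u := fun i : ℕ => prodX (i + 1) b * (2 / (-Real.log b)) / a) (t := Ioo a b) (y₀ := t) (y := t)
    (((summable_prodX hb).mul_right _).div_const _) isOpen_Ioo isPreconnected_Ioo
    (fun i y hy => hasDerivAt_prodX (i + 1) (hsub y hy)) (fun i y hy => ?_) ⟨hat, htb⟩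
    (summable_prodX ht) ⟨hat, htb⟩
  · refine key.congr_deriv (tendsto_nhds_unique ?_ (((((tendsto_eta_top ht).pow 2).add
      (tendsto_zeta_top ht)).div_const (2 * t))))
    have hs : Summable fun i : ℕ => prodX (i + 1) t * eta ((i + 1 : ℕ) : ℕ∞) t / t := by
      refine (((summable_prodX ht).mul_right (2 / (-Real.log t))).div_const t).of_nonneg_of_le
        (fun i => ?_) fun i => ?_
      · have := eta_nat_nonneg (i + 1) (hsub t ⟨hat, htb⟩)
        have := prodX_pos (i + 1) (hsub t ⟨hat, htb⟩)
        have := ht.1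
        positivity
      · have := prodX_pos (i + 1) (hsub t ⟨hat, htb⟩)
        have := ht.1
        gcongr
        exact eta_nat_le _ ht
    refine hs.hasSum.tendsto_sum_nat.congr fun n => ?_
    induction n with
    | zero => simp
    | succ n ih =>
      rw [Finset.sum_range_succ, ih, zeta_succ, eta_succ]
      have := ht.1.ne'
      field_simp
      ring
  · have hy' := hsub y hy
    have h1 := prodX_pos (i + 1) hy'
    have h2 := eta_nat_nonneg (i + 1) hy'
    have h3 := hy'.1
    have h5 : prodX (i + 1) y ≤ prodX (i + 1) b :=
      prodX_monotoneOn _ hy' ⟨hb.1, hb.2.le⟩ hy.2.le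
    have h6 : eta ((i + 1 : ℕ) : ℕ∞) y ≤ 2 / (-Real.log b) := by
      refine le_trans ?_ (eta_nat_le (i + 1) hb)
      rw [eta_natCast, eta_natCast]
      exact Finset.sum_le_sum fun j _ => prodX_monotoneOn _ hy' ⟨hb.1, hb.2.le⟩ hy.2.le
    rw [Real.norm_of_nonneg (by positivity)]
    have := h1.trans_le h5
    have := h2.trans h6
    gcongr
    exact hy.1.le

theorem hasDerivAt_eta (m : ℕ∞) {t : ℝ} (ht : t ∈ Ioo 0 1) :
    HasDerivAt (eta m) ((eta m t ^ 2 + zeta m t) / (2 * t)) t := by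
  induction m using ENat.recTopCoe with
  | top => exact hasDerivAt_eta_top ht
  | coe n => exact hasDerivAt_eta_nat n ⟨ht.1, ht.2.le⟩

theorem continuousOn_eta (m : ℕ∞) : ContinuousOn (eta m) (Ioo 0 1) := fun _ ht =>
  (hasDerivAt_eta m ht).continuousAt.continuousWithinAt

theorem continuousOn_zeta (m : ℕ∞) : ContinuousOn (zeta m) (Ioo 0 1) := by
  have hP : ∀ i, ContinuousOn (fun t => prodX i t ^ 2) (Ioo 0 1) := fun i t ht =>
    ((hasDerivAt_prodX i ⟨ht.1, ht.2.le⟩).continuousAt.pow 2).continuousWithinAt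
  induction m using ENat.recTopCoe with
  | top =>
    intro t ht
    obtain ⟨b, htb, hb1⟩ := exists_between ht.2
    have hb : b ∈ Ioo 0 1 := ⟨ht.1.trans htb, hb1⟩
    have hsub : Ioo 0 b ⊆ Ioo 0 1 := Ioo_subset_Ioo_right hb1.le
    have : ContinuousOn (zeta ⊤) (Ioo 0 b) :=
      continuousOn_tsum (fun i => (hP (i + 1)).mono hsub) (summable_prodX_sq hb) fun i y hy => by
        have hy' : y ∈ Ioc 0 1 := ⟨hy.1, (hy.2.trans hb1).le⟩
        have := prodX_pos (i + 1) hy'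
        rw [Real.norm_of_nonneg (by positivity)]
        gcongr
        exact prodX_monotoneOn _ hy' ⟨hb.1, hb.2.le⟩ hy.2.le
    exact (this.continuousAt (Ioo_mem_nhds ht.1 htb)).continuousWithinAt
  | coe n =>
    have : zeta n = fun t => ∑ i ∈ Finset.range n, prodX (i + 1) t ^ 2 := funext (zeta_natCast n)
    rw [this]
    exact continuousOn_finsetSum _ fun i _ => hP (i + 1)

/-! ### The pointwise inequality -/

/-- Second-order Taylor bound for the loss in Young's inequality near its equality case. -/
theorem exists_young_loss_bound {p : ℝ} (hp : 1 < p) :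
    ∃ C > 0, ∃ r > 0, ∀ x : ℝ, |x| ≤ r →
      -(p / (p - 1) / 2) * x ^ 2 - C * |x| ^ 3 ≤
        p * (1 + x) - (p - 1) * (1 + x) ^ (p / (p - 1)) - 1 := by
  set q := p / (p - 1) with hq
  have h1 : (fun x : ℝ => (1 + x) ^ q - (1 + q * x + q * (q - 1) / 2 * x ^ 2)) =O[𝓝 0]
      fun x => x ^ 3 := by
    have h := (Real.one_add_rpow_hasFPowerSeriesAt_zero (a := q)).isBigO_sub_partialSum_pow 3
    refine (h.congr_left fun x => ?_).norm_right.trans ?_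
    · simp [FormalMultilinearSeries.partialSum, Finset.sum_range_succ, binomialSeries,
        FormalMultilinearSeries.ofScalars]
      left
      rw [Ring.choose_eq_smul]
      simp [descPochhammer_succ_left, Polynomial.smeval_mul]
      ring
    · exact Asymptotics.IsBigO.of_bound 1 (.of_forall fun x => by simp)
  obtain ⟨C, hC, hb⟩ := h1.exists_pos
  obtain ⟨r, hr, hb⟩ := Metric.nhds_basis_closedBall.eventually_iff.1 hb.bound
  have hp1 : 0 < p - 1 := by linarith
  refine ⟨(p - 1) * C, by positivity, r, hr, fun x hx => ?_⟩
  have h2 := (le_abs_self _).trans (hb (show x ∈ _ by simpa using hx))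
  rw [norm_pow, Real.norm_eq_abs] at h2
  have e1 : (p - 1) * q = p := by rw [hq]; field_simp
  have e2 : (p - 1) * (q * (q - 1) / 2) = q / 2 := by rw [hq]; field_simp; ring
  have h3 := mul_le_mul_of_nonneg_left h2 hp1.le
  have : (p - 1) * ((1 + x) ^ q - (1 + q * x + q * (q - 1) / 2 * x ^ 2)) =
    (p - 1) * (1 + x) ^ q - ((p - 1) + ((p - 1) * q) * x + ((p - 1) * (q * (q - 1) / 2)) * x ^ 2) := by ring
  rw [this, e1, e2] at h3
  linarith

theorem mul_div_sq_le {W h y w R : ℝ} (hw : 0 ≤ w) (hy : 0 ≤ y) (hwy : w * y ≤ 1 / 2)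
    (hW : 1 - w * y ≤ W) (hh : |h| ≤ R * y) :
    W * (h / W) ^ 2 ≤ h ^ 2 + 2 * w * R ^ 2 * y ^ 3 := by
  have hW0 : 0 < W := by linarith
  have h1 : W * (h / W) ^ 2 = h ^ 2 / W := by field_simp
  have h2 : h ^ 2 / W ≤ h ^ 2 * (1 + 2 * w * y) := by
    rw [div_le_iff₀ hW0]
    have h4 : 1 ≤ (1 + 2 * w * y) * W := by
      have h4 : 0 ≤ w * y := by positivity
      calc 1 ≤ (1 + 2 * w * y) * (1 - w * y) := by nlinarith
        _ ≤ _ := by gcongr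
    calc h ^ 2 = h ^ 2 * 1 := (mul_one _).symm
      _ ≤ h ^ 2 * ((1 + 2 * w * y) * W) := by gcongr
      _ = _ := by ring
  have h3 : h ^ 2 ≤ R ^ 2 * y ^ 2 := by
    rw [← mul_pow, ← sq_abs h]; gcongr
  have h5 : h ^ 2 * (2 * w * y) ≤ R ^ 2 * y ^ 2 * (2 * w * y) := by gcongr
  rw [h1]
  linarith

theorem mul_abs_div_cube_le {W h y R : ℝ} (hR : 0 ≤ R) (hy : 0 ≤ y) (hW : 1 / 2 ≤ W)
    (hh : |h| ≤ R * y) : W * |h / W| ^ 3 ≤ 4 * R ^ 3 * y ^ 3 := by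
  have hW0 : 0 < W := by linarith
  have h1 : W * |h / W| ^ 3 = |h| ^ 3 / W ^ 2 := by
    rw [abs_div, abs_of_pos hW0]; field_simp
  rw [h1, div_le_iff₀ (by positivity)]
  have h2 : |h| ^ 3 ≤ R ^ 3 * y ^ 3 := by rw [← mul_pow]; gcongr
  have h3 : 1 ≤ 4 * W ^ 2 := by nlinarith
  calc |h| ^ 3 ≤ R ^ 3 * y ^ 3 * 1 := by linarith
    _ ≤ R ^ 3 * y ^ 3 * (4 * W ^ 2) := by gcongr
    _ = _ := by ring

/-- The pointwise inequality behind the theorem, with `y`, `z` and `W` standing for `η`, `ζ` and the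
weight, and `f` for the profile of the vector field. The orders `1`, `y`, `y ^ 2` match exactly; the
coefficient `b`, of the sign of `H`, makes the order `y ^ 3` nonnegative. -/
theorem exists_pointwise_ineq {p H : ℝ} (hp : 1 < p) (hH : H ≠ 0) (α β γ : ℝ) :
    ∃ b, ∃ ε > 0, ∀ y z W f : ℝ, 0 < y → y ≤ ε → y ^ 2 / 16 ≤ z → z ≤ y ^ 2 →
      W = 1 + α * y + β * y ^ 2 + γ * z →
      f = 1 + (α + (p - 1) / (p * H)) * y + b * y ^ 2 →
      0 < W ∧ 0 < f ∧
      W + α / (2 * H) * (y ^ 2 + z) + (p - 1) / (p * H) / (2 * H) * z ≤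
        p * f - (p - 1) * W * (f / W) ^ (p / (p - 1)) +
          1 / H * ((α + (p - 1) / (p * H)) * (y ^ 2 + z) / 2 + b * y * (y ^ 2 + z)) := by
  obtain ⟨C, hC, r, hr, hloss⟩ := exists_young_loss_bound hp
  have hp1 : 0 < p - 1 := by linarith
  set q := p / (p - 1) with hq
  set κ := (p - 1) / (p * H) with hκ
  -- `w₀ y` bounds `|W - 1|`, `R y` bounds `|f - W|` independently of `b = H B`, `Q y ^ 2` bounds
  -- `|f - W - κ y|`; the summands of `B` are the coefficients of the third-order errors.
  have hq0 : 0 < q := by positivity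
  have hqκ : q * κ = 1 / H := by rw [hq, hκ]; field_simp
  set w₀ := |α| + |β| + |γ| with hw₀
  set R := |κ| + 1 with hR
  set B := 16 * ((|β| + |γ|) / |H| + 1 + q * w₀ * R ^ 2 + 4 * C * R ^ 3) with hB
  set Q := |H * B| + |β| + |γ| with hQ
  have hw₀0 : 0 ≤ w₀ := by positivity
  have hR0 : 0 < R := by positivity
  have hB0 : 0 < B := by positivity
  have hQ0 : 0 ≤ Q := by positivity
  obtain ⟨ε, hε, hε1, hε2, hε3, hε4, hε5, hε6⟩ : ∃ ε > 0, ε ≤ 1 ∧ w₀ * ε ≤ 1 / 2 ∧ Q * ε ≤ 1 ∧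
      2 * R * ε ≤ r ∧ 2 * R * ε ≤ 1 / 2 ∧ q / 2 * Q ^ 2 * ε ≤ 1 := by
    have T : ∀ a c : ℝ, 0 < c → ∀ᶠ ε in 𝓝[>] (0 : ℝ), a * ε ≤ c := fun a c hc => by
      have : Tendsto (fun ε : ℝ => a * ε) (𝓝[>] 0) (𝓝 (a * 0)) :=
        ((continuous_const_mul a).tendsto 0).mono_left nhdsWithin_le_nhds
      rw [mul_zero] at this
      exact this.eventually_le_const hc
    obtain ⟨ε, h⟩ := ((T 1 1 one_pos).and ((T w₀ (1 / 2) (by norm_num)).and ((T Q 1 one_pos).and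
      ((T (2 * R) r hr).and ((T (2 * R) (1 / 2) (by norm_num)).and ((T (q / 2 * Q ^ 2) 1
      one_pos).and self_mem_nhdsWithin)))))).exists
    exact ⟨ε, h.2.2.2.2.2.2, by simpa using h.1, h.2.1, h.2.2.1, h.2.2.2.1, h.2.2.2.2.1,
      h.2.2.2.2.2.1⟩
  clear_value q κ w₀ R B Q
  refine ⟨H * B, ε, hε, fun y z W f hy hyε hz1 hz2 hW hf => ?_⟩
  have hz0 : 0 ≤ z := le_trans (by positivity) hz1
  have hy1 : y ≤ 1 := hyε.trans hε1
  have hyy : y ^ 2 ≤ y := by nlinarith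
  have hwy : w₀ * y ≤ 1 / 2 := (mul_le_mul_of_nonneg_left hyε hw₀0).trans hε2
  have hQy : Q * y ≤ 1 := (mul_le_mul_of_nonneg_left hyε hQ0).trans hε3
  have hRy : 2 * R * y ≤ r := (mul_le_mul_of_nonneg_left hyε (by positivity)).trans hε4
  have hRy' : 2 * R * y ≤ 1 / 2 := (mul_le_mul_of_nonneg_left hyε (by positivity)).trans hε5
  have hQQ : q / 2 * Q ^ 2 * y ≤ 1 := (mul_le_mul_of_nonneg_left hyε (by positivity)).trans hε6
  have hw : |W - 1| ≤ w₀ * y := by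
    have : W - 1 = α * y + β * y ^ 2 + γ * z := by rw [hW]; ring
    rw [this]
    refine (abs_add_three _ _ _).trans ?_
    rw [abs_mul, abs_mul, abs_mul, abs_of_pos hy, abs_of_nonneg (sq_nonneg y), abs_of_nonneg hz0,
      hw₀, add_mul, add_mul]
    gcongr
    exact hz2.trans hyy
  have hW2 := (abs_le.1 hw).1
  have hWhalf : 1 / 2 ≤ W := by linarith
  have hW0 : 0 < W := by linarith
  set e := H * B * y ^ 2 - β * y ^ 2 - γ * z with he
  have heQ : |e| ≤ Q * y ^ 2 := by
    refine (abs_sub _ _).trans ?_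
    have h1 := abs_sub (H * B * y ^ 2) (β * y ^ 2)
    rw [abs_mul, abs_mul β, abs_of_nonneg (sq_nonneg y)] at h1
    rw [abs_mul γ, abs_of_nonneg hz0]
    have h2 : |γ| * z ≤ |γ| * y ^ 2 := by gcongr
    rw [hQ]
    linarith
  set h := κ * y + e with hh
  have hfh : f = W + h := by rw [hf, hW, hh, he]; ring
  have hhR : |h| ≤ R * y := by
    refine (abs_add_le _ _).trans ?_
    rw [abs_mul, abs_of_pos hy, hR]
    have : Q * y * y ≤ 1 * y := by gcongr
    linarith
  have hδ : |h / W| ≤ 2 * R * y := by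
    rw [abs_div, abs_of_pos hW0, div_le_iff₀ hW0]
    calc |h| ≤ 2 * R * y * (1 / 2) := by linarith
      _ ≤ 2 * R * y * W := by gcongr
  have hfW : f / W = 1 + h / W := by rw [hfh]; field_simp
  have hf0 : 0 < f := by
    have h1 := (abs_le.1 hδ).1
    have h2 : 0 < f / W := by rw [hfW]; linarith
    exact (div_pos_iff_of_pos_right hW0).1 h2
  refine ⟨hW0, hf0, ?_⟩
  have key := mul_le_mul_of_nonneg_left (hloss (h / W) (hδ.trans hRy)) hW0.le
  rw [← hfW] at key
  have k1 : W * (p * (f / W) - (p - 1) * (f / W) ^ q - 1) =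
      p * f - (p - 1) * W * (f / W) ^ q - W := by
    have : W * (p * (f / W)) = p * f := by field_simp
    linear_combination this
  have k2 := mul_div_sq_le hw₀0 hy.le hwy (by linarith : 1 - w₀ * y ≤ W) hhR
  have k3 := mul_abs_div_cube_le hR0.le hy.le hWhalf hhR
  have k4 : q / 2 * h ^ 2 ≤ κ / (2 * H) * y ^ 2 + 1 / H * y * e + y ^ 3 := by
    have h1 : q / 2 * h ^ 2 = (q * κ) * κ / 2 * y ^ 2 + (q * κ) * y * e + q / 2 * e ^ 2 := by
      rw [hh]; ring
    have h2 : q / 2 * e ^ 2 ≤ q / 2 * (Q * y ^ 2) ^ 2 := by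
      rw [← sq_abs e]; gcongr
    have h3 : q / 2 * (Q * y ^ 2) ^ 2 = (q / 2 * Q ^ 2 * y) * y ^ 3 := by ring
    have h4 : (q / 2 * Q ^ 2 * y) * y ^ 3 ≤ 1 * y ^ 3 := by gcongr
    have h5 : 1 / H * κ / 2 = κ / (2 * H) := by field_simp
    rw [h1, hqκ, h5]
    linarith
  -- The cross term `b y ^ 3 / H` of the loss cancels the gain `b y ^ 3 / H`, leaving `b y z / H`.
  have k5 : 1 / H * y * e = B * y ^ 3 - 1 / H * y * (β * y ^ 2 + γ * z) := by
    rw [he]; field_simp; ring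
  have k6 : 1 / H * (H * B * y * (y ^ 2 + z)) = B * y ^ 3 + B * y * z := by
    field_simp
  have k7 : -((|β| + |γ|) / |H| * y ^ 3) ≤ 1 / H * y * (β * y ^ 2 + γ * z) := by
    have h1 : |1 / H * y * (β * y ^ 2 + γ * z)| ≤ (|β| + |γ|) / |H| * y ^ 3 := by
      rw [abs_mul, abs_mul, abs_div, abs_one, abs_of_pos hy]
      have h2 : |β * y ^ 2 + γ * z| ≤ (|β| + |γ|) * y ^ 2 := by
        refine (abs_add_le _ _).trans ?_
        rw [abs_mul, abs_mul, abs_of_nonneg (sq_nonneg y), abs_of_nonneg hz0, add_mul]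
        gcongr
      calc 1 / |H| * y * |β * y ^ 2 + γ * z| ≤ 1 / |H| * y * ((|β| + |γ|) * y ^ 2) := by gcongr
        _ = _ := by ring
    exact (abs_le.1 h1).1
  have k8 : ((|β| + |γ|) / |H| + 1 + q * w₀ * R ^ 2 + 4 * C * R ^ 3) * y ^ 3 ≤ B * y * z := by
    calc _ = B * y * (y ^ 2 / 16) := by rw [hB]; ring
      _ ≤ _ := by gcongr
  have k9 := mul_le_mul_of_nonneg_left k2 (half_pos hq0).le
  have k10 := mul_le_mul_of_nonneg_left k3 hC.le
  have k11 : 1 / H * ((α + κ) * (y ^ 2 + z) / 2 + H * B * y * (y ^ 2 + z)) =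
      α / (2 * H) * (y ^ 2 + z) + κ / (2 * H) * (y ^ 2 + z) + 1 / H * (H * B * y * (y ^ 2 + z)) := by
    field_simp
  have k12 : W * (-(q / 2) * (h / W) ^ 2 - C * |h / W| ^ 3) =
      -(q / 2 * (W * (h / W) ^ 2)) - C * (W * |h / W| ^ 3) := by ring
  rw [k1, k12] at key
  rw [k11, k6]
  linarith

/-! ### Extension of distributional inequalities to Lipschitz test functions -/

section Mollification

variable {E : Type*} [NormedAddCommGroup E] [InnerProductSpace ℝ E] [FiniteDimensional ℝ E]
  [MeasurableSpace E] [BorelSpace E] {C : ℝ≥0} {φ : E → ℝ}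

theorem locallyIntegrable_fderiv_of_lipschitz (hφ : LipschitzWith C φ) :
    LocallyIntegrable (fderiv ℝ φ) := by
  have : MemLp (fderiv ℝ φ) ⊤ (volume : Measure E) :=
    memLp_top_of_bound (measurable_fderiv ℝ φ).aestronglyMeasurable C
      (.of_forall fun x => norm_fderiv_le_of_lipschitz ℝ hφ)
  exact this.locallyIntegrable le_top

/-- Differentiating a mollification of a Lipschitz function amounts to mollifying its
almost-everywhere derivative. -/
theorem hasFDerivAt_convolution_of_lipschitz (hφ : LipschitzWith C φ) {w : E → ℝ}
    (hw : ContDiff ℝ ∞ w) (hwc : HasCompactSupport w) (x : E) :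
    HasFDerivAt (w ⋆[lsmul ℝ ℝ] φ) ((w ⋆[lsmul ℝ ℝ] fderiv ℝ φ) x) x := by
  have h1 : HasFDerivAt (w ⋆[lsmul ℝ ℝ] φ) _ x :=
    hwc.hasFDerivAt_convolution_left (lsmul ℝ ℝ) (hw.of_le (by simp))
      hφ.continuous.locallyIntegrable (μ := volume) x
  suffices hEq : (w ⋆[lsmul ℝ ℝ] fderiv ℝ φ) x =
      (fderiv ℝ w ⋆[(lsmul ℝ ℝ).precompL E] φ) x from hEq ▸ h1
  obtain ⟨D, hD⟩ : ∃ D, LipschitzWith D w := hw.lipschitzWith_of_hasCompactSupport hwc (by simp)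
  have hφx : LipschitzWith C (fun t => φ (x - t)) := by
    intro a b
    simpa using hφ (x - a) (x - b)
  have e1 : ConvolutionExistsAt w (fderiv ℝ φ) x (lsmul ℝ ℝ) volume :=
    hwc.convolutionExists_left _ hw.continuous (locallyIntegrable_fderiv_of_lipschitz hφ) x
  have e2 : ConvolutionExistsAt (fderiv ℝ w) φ x ((lsmul ℝ ℝ).precompL E) volume :=
    (hwc.fderiv ℝ).convolutionExists_left _ (hw.continuous_fderiv (by simp))
      hφ.continuous.locallyIntegrable x
  ext v
  rw [convolution_def, convolution_def, ContinuousLinearMap.integral_apply e1,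
    ContinuousLinearMap.integral_apply e2]
  -- Integration by parts moves the derivative from the kernel to the Lipschitz function.
  have key := hφx.integral_lineDeriv_mul_eq (μ := volume) hD hwc (-v)
  simp only [neg_neg] at key
  have l1 : ∀ᵐ t : E, lineDeriv ℝ (fun t => φ (x - t)) t (-v) = fderiv ℝ φ (x - t) v := by
    have hd : ∀ᵐ t : E, DifferentiableAt ℝ φ (x - t) :=
      (Measure.measurePreserving_sub_left volume x).quasiMeasurePreserving.ae hφ.ae_differentiableAt
    filter_upwards [hd] with t ht
    have hsub : HasFDerivAt (fun t : E => x - t) (-ContinuousLinearMap.id ℝ E) t := by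
      simpa using (hasFDerivAt_id t).const_sub x
    have : HasLineDerivAt ℝ (fun t => φ (x - t)) _ t (-v) := (ht.hasFDerivAt.comp t hsub).hasLineDerivAt (-v)
    simpa using this.lineDeriv
  have l2 : ∀ t : E, lineDeriv ℝ w t v = fderiv ℝ w t v := fun t =>
    (hw.differentiable (by simp) t).lineDeriv_eq_fderiv
  simp only [l2] at key
  calc _ = ∫ t, lineDeriv ℝ (fun t => φ (x - t)) t (-v) * w t := by
        refine integral_congr_ae ?_
        filter_upwards [l1] with t ht
        simp [ht, mul_comm]
    _ = _ := key
    _ = _ := by simp [ContinuousLinearMap.precompL_apply]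

theorem convolution_bump_nonneg (ρ : ContDiffBump (0 : E)) (h0 : ∀ x, 0 ≤ φ x) (x : E) :
    0 ≤ (ρ.normed volume ⋆[lsmul ℝ ℝ] φ) x :=
  integral_nonneg fun t => mul_nonneg (ρ.nonneg_normed t) (h0 _)

theorem dist_convolution_bump_le (hφ : LipschitzWith C φ) (ρ : ContDiffBump (0 : E)) (x : E) :
    dist ((ρ.normed volume ⋆[lsmul ℝ ℝ] φ) x) (φ x) ≤ C * ρ.rOut := by
  refine ρ.dist_normed_convolution_le hφ.continuous.aestronglyMeasurable fun y hy => ?_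
  exact (hφ.dist_le_mul y x).trans (by gcongr; exact (mem_ball.1 hy).le)

theorem norm_fderiv_convolution_bump_le (hφ : LipschitzWith C φ) (ρ : ContDiffBump (0 : E)) (x : E) :
    ‖fderiv ℝ (ρ.normed volume ⋆[lsmul ℝ ℝ] φ) x‖ ≤ C := by
  rw [(hasFDerivAt_convolution_of_lipschitz hφ ρ.contDiff_normed ρ.hasCompactSupport_normed
    x).fderiv, ← dist_zero_right]
  refine dist_convolution_le C.2 ρ.support_normed_eq.subset ρ.nonneg_normed ρ.integral_normed
    (measurable_fderiv ℝ φ).aestronglyMeasurable fun y _ => ?_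
  rw [dist_zero_right]
  exact norm_fderiv_le_of_lipschitz ℝ hφ

theorem tsupport_convolution_bump_subset (ρ : ContDiffBump (0 : E)) :
    tsupport (ρ.normed volume ⋆[lsmul ℝ ℝ] φ) ⊆ cthickening ρ.rOut (tsupport φ) := by
  refine closure_minimal (fun x hx => ?_) isClosed_cthickening
  obtain ⟨a, ha, b, hb, rfl⟩ := support_convolution_subset (L := lsmul ℝ ℝ) hx
  rw [ρ.support_normed_eq] at ha
  refine mem_cthickening_of_dist_le _ b _ _ (subset_tsupport _ hb) ?_
  simpa using (mem_ball_zero_iff.1 ha).le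

end Mollification

section Extension

variable {N : ℕ} {U : Set (EuclideanSpace ℝ (Fin N))} {d φ : EuclideanSpace ℝ (Fin N) → ℝ}
  {A C : ℝ≥0} {c k : ℝ}

/-- The product rule, in the weak formulation of `d Δd` against a Lipschitz function. -/
theorem mulLaplacian_eq (hd : LipschitzWith A d) (hφ : LipschitzWith C φ) :
    mulLaplacian U d φ =
      -∫ x in U, (‖gradient d x‖ ^ 2 * φ x + d x * fderiv ℝ φ x (gradient d x)) := by
  rw [mulLaplacian]
  congr 1
  refine integral_congr_ae (ae_restrict_of_ae ?_)
  filter_upwards [hd.ae_differentiableAt, hφ.ae_differentiableAt] with x h1 h2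
  rw [inner_gradient_right, (h1.hasFDerivAt.fun_mul h2.hasFDerivAt).fderiv]
  simp only [add_apply, smul_apply, smul_eq_mul, conj_trivial, ← inner_gradient_left,
    real_inner_self_eq_norm_sq]
  ring

/-- A distributional inequality for `d Δd`, assumed for smooth test functions, persists for Lipschitz
ones: mollify. -/
theorem DistribIneq.lipschitz (h : DistribIneq U d c k) (hU : IsOpen U) (hd : LipschitzWith A d)
    (hφ : LipschitzWith C φ) (hφc : HasCompactSupport φ) (hφU : tsupport φ ⊆ U)
    (h0 : ∀ x, 0 ≤ φ x) :
    0 ≤ c * (mulLaplacian U d φ - k * (∫ x in U, φ x) + ∫ x in U, φ x) := by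
  obtain ⟨δ, hδ, hδU⟩ := hφc.isCompact.exists_cthickening_subset_open hU hφU
  -- The radii keep a bounded ratio, as the Lebesgue differentiation theorem requires.
  let ρ : ℕ → ContDiffBump (0 : EuclideanSpace ℝ (Fin N)) := fun n =>
    ⟨δ / 2 / (n + 1), δ / (n + 1), by positivity, by gcongr; linarith⟩
  have hρ : Tendsto (fun n => (ρ n).rOut) atTop (𝓝 0) := by
    simpa [ρ, div_eq_mul_inv] using
      (tendsto_one_div_add_atTop_nhds_zero_nat (𝕜 := ℝ)).const_mul δ
  have hρδ : ∀ n, (ρ n).rOut ≤ δ := fun n => div_le_self hδ.le (by simp)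
  set ψ : ℕ → EuclideanSpace ℝ (Fin N) → ℝ := fun n => (ρ n).normed volume ⋆[lsmul ℝ ℝ] φ with hψ
  set Q := cthickening δ (tsupport φ) with hQ
  have hQc : IsCompact Q := hφc.isCompact.cthickening
  have hψQ : ∀ n, tsupport (ψ n) ⊆ Q := fun n =>
    (tsupport_convolution_bump_subset _).trans (cthickening_mono (hρδ n) _)
  have hψs : ∀ n, ContDiff ℝ ∞ (ψ n) := fun n =>
    (ρ n).hasCompactSupport_normed.contDiff_convolution_left _ (ρ n).contDiff_normed
      hφ.continuous.locallyIntegrable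
  have hψc : ∀ n, HasCompactSupport (ψ n) := fun n => hQc.of_isClosed_subset
    (isClosed_tsupport _) (hψQ n)
  have hψL : ∀ n, LipschitzWith C (ψ n) := fun n =>
    lipschitzWith_of_nnnorm_fderiv_le ((hψs n).differentiable (by simp))
      (fun x => norm_fderiv_convolution_bump_le hφ (ρ n) x)
  have hlim : ∀ x, Tendsto (fun n => ψ n x) atTop (𝓝 (φ x)) := fun x =>
    ContDiffBump.convolution_tendsto_right_of_continuous hρ hφ.continuous x
  have hlim' : ∀ᵐ x, Tendsto (fun n => fderiv ℝ (ψ n) x) atTop (𝓝 (fderiv ℝ φ x)) := by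
    have := ContDiffBump.ae_convolution_tendsto_right_of_locallyIntegrable (φ := ρ) (K := 2) hρ
      (.of_forall fun n => by simp only [ρ]; apply le_of_eq; ring)
      (locallyIntegrable_fderiv_of_lipschitz hφ)
    filter_upwards [this] with x hx
    refine hx.congr fun n => ?_
    exact (hasFDerivAt_convolution_of_lipschitz hφ (ρ n).contDiff_normed
      (ρ n).hasCompactSupport_normed x).fderiv.symm
  obtain ⟨M, hM⟩ := hφc.exists_bound_of_continuous hφ.continuous
  obtain ⟨R, hR⟩ := hQc.exists_bound_of_continuousOn hd.continuous.continuousOn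
  have hψb : ∀ n x, ‖ψ n x‖ ≤ M + C * δ := fun n x => by
    have h1 := dist_convolution_bump_le hφ (ρ n) x
    have h2 : (C : ℝ) * (ρ n).rOut ≤ C * δ := by gcongr; exact hρδ n
    rw [dist_eq_norm] at h1
    have h3 := norm_le_norm_add_norm_sub' (ψ n x) (φ x)
    linarith [hM x]
  have hgrad : ∀ x, ‖gradient d x‖ ≤ A := fun x => by
    rw [gradient, LinearIsometryEquiv.norm_map]
    exact norm_fderiv_le_of_lipschitz ℝ hd
  have hMC : 0 ≤ M + C * δ := (norm_nonneg _).trans (hψb 0 0)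
  have hgm : Measurable (gradient d) :=
    (InnerProductSpace.toDual ℝ _).symm.continuous.measurable.comp (measurable_fderiv ℝ d)
  have hz : ∀ n x, x ∉ Q → ψ n x = 0 ∧ fderiv ℝ (ψ n) x = 0 := fun n x hx =>
    ⟨image_eq_zero_of_notMem_tsupport fun h => hx (hψQ n h),
      image_eq_zero_of_notMem_tsupport fun h => hx (hψQ n (tsupport_fderiv_subset ℝ h))⟩
  have T1 : Tendsto (fun n => ∫ x in U, ψ n x) atTop (𝓝 (∫ x in U, φ x)) := by
    refine tendsto_integral_of_dominated_convergence (Q.indicator fun _ => M + C * δ)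
      (fun n => (hψs n).continuous.aestronglyMeasurable) ?_ ?_ (.of_forall hlim)
    · exact ((integrable_indicator_iff hQc.measurableSet).2
        (integrableOn_const hQc.measure_lt_top.ne)).restrict
    · refine fun n => .of_forall fun x => ?_
      by_cases hx : x ∈ Q
      · simpa [hx] using hψb n x
      · simp [hx, (hz n x hx).1]
  have T2 : Tendsto (fun n => ∫ x in U, (‖gradient d x‖ ^ 2 * ψ n x
        + d x * fderiv ℝ (ψ n) x (gradient d x))) atTop
      (𝓝 (∫ x in U, (‖gradient d x‖ ^ 2 * φ x + d x * fderiv ℝ φ x (gradient d x)))) := by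
    refine tendsto_integral_of_dominated_convergence
      (Q.indicator fun _ => (A : ℝ) ^ 2 * (M + C * δ) + R * (C * A)) (fun n => ?_) ?_ ?_ ?_
    · refine Measurable.aestronglyMeasurable ?_
      refine ((hgm.norm.pow_const 2).mul (hψs n).continuous.measurable).add
        (hd.continuous.measurable.mul ?_)
      exact isBoundedBilinearMap_apply.continuous.measurable.comp
        (((hψs n).continuous_fderiv (by simp)).measurable.prodMk hgm)
    · exact ((integrable_indicator_iff hQc.measurableSet).2
        (integrableOn_const hQc.measure_lt_top.ne)).restrict
    · refine fun n => .of_forall fun x => ?_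
      by_cases hx : x ∈ Q
      · rw [indicator_of_mem hx]
        refine (norm_add_le _ _).trans ?_
        rw [norm_mul, norm_mul, norm_pow, norm_norm]
        gcongr
        · exact hgrad x
        · exact hψb n x
        · exact (norm_nonneg _).trans (hR x hx)
        · exact hR x hx
        · exact (ContinuousLinearMap.le_opNorm _ _).trans (by
            gcongr
            · exact norm_fderiv_convolution_bump_le hφ (ρ n) x
            · exact hgrad x)
      · simp [hx, (hz n x hx).1, (hz n x hx).2]
    · refine ae_restrict_of_ae ?_
      filter_upwards [hlim'] with x hx
      exact ((hlim x).const_mul _).add ((((ContinuousLinearMap.apply ℝ ℝ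
        (gradient d x)).continuous.tendsto _).comp hx).const_mul _)
  have hn : ∀ n, 0 ≤ c * (mulLaplacian U d (ψ n) - k * (∫ x in U, ψ n x) + ∫ x in U, ψ n x) :=
    fun n => h (ψ n) ⟨hψs n, hψc n, (hψQ n).trans hδU⟩ (convolution_bump_nonneg (ρ n) h0)
  simp only [fun n => mulLaplacian_eq (U := U) hd (hψL n)] at hn
  rw [mulLaplacian_eq hd hφ]
  exact ge_of_tendsto' (((T2.neg.sub (T1.const_mul k)).add T1).const_mul c) hn

end Extension

/-! ### The gradient of the distance function -/

section Distance

variable {E : Type*} [NormedAddCommGroup E] [InnerProductSpace ℝ E] [FiniteDimensional ℝ E]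

/-- The eikonal equation: off `K`, the distance to `K` decreases at unit speed along the segment to a
nearest point. -/
theorem norm_gradient_infDist {K : Set E} (hK : IsClosed K) (hne : K.Nonempty) {x : E} (hx : x ∉ K)
    (hd : DifferentiableAt ℝ (fun y => infDist y K) x) :
    ‖gradient (fun y => infDist y K) x‖ = 1 := by
  have hlip : LipschitzWith 1 (fun y => infDist y K) := lipschitz_infDist_pt K
  have hle : ‖gradient (fun y => infDist y K) x‖ ≤ 1 := by
    rw [gradient, LinearIsometryEquiv.norm_map]
    simpa using norm_fderiv_le_of_lipschitz ℝ hlip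
  obtain ⟨y, hy, hxy⟩ := hK.exists_infDist_eq_dist hne x
  have hr : 0 < dist x y := dist_pos.2 fun h => hx (h ▸ hy)
  have hseg : ∀ s ∈ Icc (0 : ℝ) 1, infDist (x + s • (y - x)) K = (1 - s) * dist x y := fun s hs => by
    have e : dist (x + s • (y - x)) y = (1 - s) * dist x y := by
      rw [dist_eq_norm, dist_eq_norm, show x + s • (y - x) - y = (1 - s) • (x - y) by module,
        norm_smul, Real.norm_of_nonneg (by linarith [hs.2])]
    refine le_antisymm (e ▸ infDist_le_dist_of_mem hy) ?_
    have h1 := infDist_le_infDist_add_dist (s := K) (x := x) (y := x + s • (y - x))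
    have h2 : dist x (x + s • (y - x)) = s * dist x y := by
      rw [dist_comm, dist_eq_norm, dist_comm x, dist_eq_norm, add_sub_cancel_left, norm_smul,
        Real.norm_of_nonneg hs.1]
    rw [hxy, h2] at h1
    linarith
  have hline : HasDerivAt (fun s : ℝ => x + s • (y - x)) (y - x) 0 := by
    simpa using ((hasDerivAt_id (0 : ℝ)).smul_const (y - x)).const_add x
  have hd' : HasFDerivAt (fun y => infDist y K) (fderiv ℝ (fun y => infDist y K) x)
      (x + (0 : ℝ) • (y - x)) := by simpa using hd.hasFDerivAt
  have h1 : HasDerivWithinAt (fun s : ℝ => infDist (x + s • (y - x)) K)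
      (fderiv ℝ (fun y => infDist y K) x (y - x)) (Icc 0 1) 0 := by
    have := hd'.comp_hasDerivAt (0 : ℝ) hline
    exact this.hasDerivWithinAt
  have h2 : HasDerivWithinAt (fun s : ℝ => infDist (x + s • (y - x)) K)
      (-1 * dist x y) (Icc 0 1) 0 := by
    refine HasDerivWithinAt.congr ?_ hseg (hseg 0 (by simp))
    exact (((hasDerivAt_id (0 : ℝ)).const_sub 1).mul_const _).hasDerivWithinAt
  have h3 := (uniqueDiffOn_Icc_zero_one 0 (by simp)).eq_deriv _ h1 h2
  rw [← inner_gradient_left] at h3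
  have h4 := abs_real_inner_le_norm (gradient (fun y => infDist y K) x) (y - x)
  rw [h3, ← dist_eq_norm, dist_comm y, neg_one_mul, abs_neg, abs_of_pos hr] at h4
  exact le_antisymm hle (le_of_mul_le_mul_right (by simpa using h4) hr)

end Distance

/-! ### Compactly supported products -/

section CompactSupport

variable {E : Type*} [NormedAddCommGroup E]

/-- A locally Lipschitz function is Lipschitz on a compact neighbourhood of its support; between the
support and the complement of that neighbourhood, boundedness suffices. -/
theorem exists_lipschitzWith_of_hasCompactSupport [ProperSpace E] {φ : E → ℝ} (h : LocallyLipschitz φ)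
    (hc : HasCompactSupport φ) : ∃ C, LipschitzWith C φ := by
  obtain ⟨C, hC⟩ := (h.locallyLipschitzOn (s := cthickening 1 (tsupport φ))
    ).exists_lipschitzOnWith_of_compact hc.isCompact.cthickening
  obtain ⟨M, hM⟩ := hc.exists_bound_of_continuous h.continuous
  have hM0 : 0 ≤ M := (norm_nonneg _).trans (hM 0)
  have key : ∀ x y, x ∈ tsupport φ → dist (φ x) (φ y) ≤ (C + M) * dist x y := fun x y hx => by
    by_cases hy : y ∈ cthickening 1 (tsupport φ)
    · refine (hC.dist_le_mul x (self_subset_cthickening _ hx) y hy).trans ?_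
      gcongr
      linarith
    · have h1 : φ y = 0 := image_eq_zero_of_notMem_tsupport fun h =>
        hy (self_subset_cthickening _ h)
      have h2 : 1 ≤ dist x y := by
        by_contra! hlt
        exact hy (mem_cthickening_of_dist_le y x 1 _ hx (by rw [dist_comm]; exact hlt.le))
      rw [h1, dist_zero_right]
      calc ‖φ x‖ ≤ (0 + M) * 1 := by simpa using hM x
        _ ≤ (C + M) * dist x y := by gcongr; exact C.2
  refine ⟨C + M.toNNReal, LipschitzWith.of_dist_le_mul fun x y => ?_⟩
  rw [NNReal.coe_add, Real.coe_toNNReal _ hM0]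
  by_cases hx : x ∈ tsupport φ
  · exact key x y hx
  by_cases hy : y ∈ tsupport φ
  · rw [dist_comm, dist_comm x]; exact key y x hy
  · rw [image_eq_zero_of_notMem_tsupport hx, image_eq_zero_of_notMem_tsupport hy, dist_self]
    positivity

theorem continuous_mul_of_tsupport_subset {U : Set E} (hU : IsOpen U) {h v : E → ℝ}
    (hh : ContinuousOn h U) (hv : Continuous v) (hvU : tsupport v ⊆ U) :
    Continuous fun x => h x * v x := by
  refine continuous_of_tsupport fun x hx => ?_
  have hxU : x ∈ U := hvU (tsupport_mul_subset_right hx)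
  exact (hh.continuousAt (hU.mem_nhds hxU)).mul hv.continuousAt

theorem integrable_mul_of_tsupport_subset [MeasurableSpace E] [BorelSpace E] {μ : Measure E}
    [IsFiniteMeasureOnCompacts μ] {U : Set E}
    (hU : IsOpen U) {h v : E → ℝ} (hh : ContinuousOn h U) (hv : Continuous v)
    (hvc : HasCompactSupport v) (hvU : tsupport v ⊆ U) :
    Integrable (fun x => h x * v x) μ :=
  (continuous_mul_of_tsupport_subset hU hh hv hvU).integrable_of_hasCompactSupport hvc.mul_left

theorem locallyLipschitz_comp_mul [NormedSpace ℝ E] {U : Set E} {I : Set ℝ} (hI : IsOpen I)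
    {d v : E → ℝ} {A : ℝ≥0} (hd : LipschitzWith A d) (hdI : MapsTo d U I) {G : ℝ → ℝ}
    (hG : ContDiffOn ℝ 1 G I) (hv : ContDiff ℝ 1 v) (hvU : tsupport v ⊆ U) :
    LocallyLipschitz fun x => G (d x) * v x := by
  intro x
  by_cases hx : x ∈ tsupport v
  · have h1 : ContDiffAt ℝ 1 (fun z : ℝ × ℝ => G z.1 * z.2) (d x, v x) := by
      refine ContDiffAt.mul ?_ contDiffAt_snd
      exact (hG.contDiffAt (hI.mem_nhds (hdI (hvU hx)))).comp (d x, v x) contDiffAt_fst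
    obtain ⟨C, t, ht, hC⟩ := h1.exists_lipschitzOnWith
    obtain ⟨B, w, hw, hB⟩ := hv.locallyLipschitz x
    have h2 : LipschitzOnWith (max A B) (fun x => (d x, v x)) w := hd.lipschitzOnWith.prodMk hB
    have h3 : ContinuousAt (fun x => (d x, v x)) x :=
      hd.continuous.continuousAt.prodMk hv.continuous.continuousAt
    refine ⟨C * max A B, w ∩ (fun x => (d x, v x)) ⁻¹' t, inter_mem hw (h3 ht), ?_⟩
    exact hC.comp (h2.mono inter_subset_left) fun y hy => hy.2
  · refine ⟨0, (tsupport v)ᶜ, (isClosed_tsupport v).isOpen_compl.mem_nhds hx, ?_⟩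
    intro a ha b hb
    simp [image_eq_zero_of_notMem_tsupport ha, image_eq_zero_of_notMem_tsupport hb]

end CompactSupport

/-! ### Testing against a function of the distance -/

section Weak

variable {N : ℕ} {U : Set (EuclideanSpace ℝ (Fin N))} {d v : EuclideanSpace ℝ (Fin N) → ℝ}
  {A : ℝ≥0} {c k : ℝ} {I : Set ℝ} {G : ℝ → ℝ}

/-- The gradient of `d` is merely measurable and bounded, which is why continuity is not enough here. -/
theorem integrable_mul_fderiv_gradient (hU : IsOpen U) (hd : LipschitzWith A d)
    {h : EuclideanSpace ℝ (Fin N) → ℝ} (hh : ContinuousOn h U) (hv : ContDiff ℝ 1 v)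
    (hvc : HasCompactSupport v) (hvU : tsupport v ⊆ U) :
    Integrable fun x => h x * fderiv ℝ v x (gradient d x) := by
  have hgm : Measurable (gradient d) :=
    (InnerProductSpace.toDual ℝ _).symm.continuous.measurable.comp (measurable_fderiv ℝ d)
  have h1 : Continuous fun x => h x • fderiv ℝ v x := by
    refine continuous_of_tsupport fun x hx => ?_
    have hxU : x ∈ U := hvU (tsupport_fderiv_subset ℝ (tsupport_smul_subset_right h _ hx))
    exact (hh.continuousAt (hU.mem_nhds hxU)).smul (hv.continuous_fderiv (by simp)).continuousAt
  have hc : HasCompactSupport fun x => h x • fderiv ℝ v x :=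
    (hvc.fderiv ℝ).mono fun x hx h0 => hx (by simp only [h0, smul_zero])
  have h2 : Integrable fun x => ‖h x • fderiv ℝ v x‖ * A :=
    (h1.integrable_of_hasCompactSupport hc).norm.mul_const _
  have h3 : Measurable fun x => (h x • fderiv ℝ v x) (gradient d x) :=
    isBoundedBilinearMap_apply.continuous.measurable.comp (h1.measurable.prodMk hgm)
  have h4 : Integrable fun x => (h x • fderiv ℝ v x) (gradient d x) := by
    refine h2.mono' h3.aestronglyMeasurable (.of_forall fun x => ?_)
    refine (ContinuousLinearMap.le_opNorm (h x • fderiv ℝ v x) _).trans ?_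
    gcongr
    rw [gradient, LinearIsometryEquiv.norm_map]
    exact norm_fderiv_le_of_lipschitz ℝ hd
  simpa only [smul_apply, smul_eq_mul] using h4

/-- The distributional inequality tested against `G(d) v`, for a function `d` with `|∇d| = 1`
almost everywhere. -/
theorem DistribIneq.integral_comp_mul (h : DistribIneq U d c k) (hU : IsOpen U)
    (hd : LipschitzWith A d) (hgrad : ∀ᵐ x, x ∈ U → ‖gradient d x‖ = 1) (hI : IsOpen I)
    (hdI : MapsTo d U I) (hG : ContDiffOn ℝ 1 G I) (hG0 : ∀ x ∈ U, 0 ≤ G (d x))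
    (hv : ContDiff ℝ 1 v) (hv0 : ∀ x, 0 ≤ v x) (hvc : HasCompactSupport v) (hvU : tsupport v ⊆ U) :
    IntegrableOn (fun x => (k * G (d x) + d x * deriv G (d x)) * v x
        + d x * G (d x) * fderiv ℝ v x (gradient d x)) U ∧
      c * (∫ x in U, ((k * G (d x) + d x * deriv G (d x)) * v x
        + d x * G (d x) * fderiv ℝ v x (gradient d x))) ≤ 0 := by
  set φ := fun x => G (d x) * v x with hφdef
  have hφc : HasCompactSupport φ := hvc.mul_left
  have hφU : tsupport φ ⊆ U := (tsupport_mul_subset_right).trans hvU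
  obtain ⟨C, hC⟩ := exists_lipschitzWith_of_hasCompactSupport
    (locallyLipschitz_comp_mul hI hd hdI hG hv hvU) hφc
  have hφ0 : ∀ x, 0 ≤ φ x := fun x => by
    by_cases hx : x ∈ U
    · exact mul_nonneg (hG0 x hx) (hv0 x)
    · rw [image_eq_zero_of_notMem_tsupport fun h => hx (hφU h)]
  have key := h.lipschitz hU hd hC hφc hφU hφ0
  rw [mulLaplacian_eq hd hC] at key
  have hGc : ContinuousOn (fun x => G (d x)) U := hG.continuousOn.comp hd.continuous.continuousOn hdI
  have hG'c : ContinuousOn (fun x => deriv G (d x)) U :=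
    (hG.continuousOn_deriv_of_isOpen hI le_rfl).comp hd.continuous.continuousOn hdI
  have i1 : Integrable φ := integrable_mul_of_tsupport_subset hU hGc hv.continuous hvc hvU
  have i2 : Integrable fun x => (d x * deriv G (d x)) * v x :=
    integrable_mul_of_tsupport_subset hU (hd.continuous.continuousOn.mul hG'c) hv.continuous hvc hvU
  have i3 : Integrable fun x => d x * G (d x) * fderiv ℝ v x (gradient d x) :=
    integrable_mul_fderiv_gradient hU hd (hd.continuous.continuousOn.mul hGc) hv hvc hvU
  have e1 : ∫ x in U, (‖gradient d x‖ ^ 2 * φ x + d x * fderiv ℝ φ x (gradient d x)) =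
      ∫ x in U, (φ x + (d x * deriv G (d x)) * v x
        + d x * G (d x) * fderiv ℝ v x (gradient d x)) := by
    refine setIntegral_congr_ae hU.measurableSet ?_
    filter_upwards [hgrad, hd.ae_differentiableAt] with x h1 h2 hxU
    have hGd : HasDerivAt G (deriv G (d x)) (d x) :=
      ((hG.differentiableOn one_ne_zero).differentiableAt (hI.mem_nhds (hdI hxU))).hasDerivAt
    have h3 : HasFDerivAt φ (G (d x) • fderiv ℝ v x + v x • (deriv G (d x) • fderiv ℝ d x)) x :=
      (hGd.comp_hasFDerivAt x h2.hasFDerivAt).mul (hv.differentiable one_ne_zero x).hasFDerivAt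
    rw [h3.fderiv, h1 hxU]
    simp only [add_apply, smul_apply, smul_eq_mul, ← inner_gradient_left (f := d),
      real_inner_self_eq_norm_sq, h1 hxU]
    ring
  have e2 : (fun x => (k * G (d x) + d x * deriv G (d x)) * v x
      + d x * G (d x) * fderiv ℝ v x (gradient d x)) = fun x =>
      k * φ x + (d x * deriv G (d x)) * v x + d x * G (d x) * fderiv ℝ v x (gradient d x) := by
    funext x; simp only [hφdef]; ring
  rw [e2]
  refine ⟨(((i1.const_mul k).add i2).add i3).integrableOn, ?_⟩
  have sum3 : ∀ {f g h : EuclideanSpace ℝ (Fin N) → ℝ}, Integrable f → Integrable g → Integrable h →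
      ∫ x in U, (f x + g x + h x) = (∫ x in U, f x) + (∫ x in U, g x) + ∫ x in U, h x :=
    fun {f g h} hf hg hh => by
      have hfg : IntegrableOn (fun x => f x + g x) U := (hf.add hg).integrableOn
      rw [integral_add hfg hh.integrableOn, integral_add hf.integrableOn hg.integrableOn]
  rw [e1, sum3 i1 i2 i3] at key
  rw [sum3 (i1.const_mul k) i2 i3, integral_const_mul]
  linarith

end Weak

/-! ### Young's inequality -/

theorem mul_rpow_sub_one_le {p x y : ℝ} (hp : 1 < p) (hx : 0 ≤ x) (hy : 0 ≤ y) :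
    p * x * y ^ (p - 1) ≤ x ^ p + (p - 1) * y ^ p := by
  have hp1 : 0 < p - 1 := by linarith
  have hpq : p.HolderConjugate (p / (p - 1)) := Real.HolderConjugate.conjExponent hp
  have h := Real.young_inequality_of_nonneg hx (Real.rpow_nonneg hy (p - 1)) hpq
  rw [← Real.rpow_mul hy, mul_div_cancel₀ _ hp1.ne'] at h
  have h2 := mul_le_mul_of_nonneg_left h (by linarith : (0 : ℝ) ≤ p)
  have h3 : p * (x ^ p / p + y ^ p / (p / (p - 1))) = x ^ p + (p - 1) * y ^ p := by
    field_simp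
  linarith

/-- Young's inequality in the form in which it is used pointwise: `r`, `a`, `b` stand for `d`, `|u|`
and `|∇u|`, and `τ` for the derivative of `|u| ^ p` in the direction `∇d`. -/
theorem young_pointwise {p s H r W f a b τ : ℝ} (hp : 1 < p) (hH : H ≠ 0) (hr : 0 < r) (hW : 0 < W)
    (hf : 0 < f) (ha : 0 ≤ a) (hb : 0 ≤ b) (hτ : |τ| ≤ p * a ^ (p - 1) * b) :
    -(|H| ^ (p - 2) * H * (r * (r ^ (s - p) * f) * τ)) ≤ r ^ s * W * b ^ p +
      (p - 1) * |H| ^ p * r ^ (s - p) * W * (f / W) ^ (p / (p - 1)) * a ^ p := by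
  have hp1 : 0 < p - 1 := by linarith
  have hH0 : 0 < |H| := abs_pos.2 hH
  set g := f / W with hg
  have hg0 : 0 < g := by positivity
  have hfg : f = W * g := by rw [hg]; field_simp
  set Y := |H| * a / r * g ^ (1 / (p - 1)) with hY
  have hY0 : 0 ≤ Y := by positivity
  have e1 : Y ^ (p - 1) = |H| ^ (p - 1) * a ^ (p - 1) / r ^ (p - 1) * g := by
    rw [hY, Real.mul_rpow (by positivity) (by positivity), ← Real.rpow_mul hg0.le,
      one_div_mul_cancel hp1.ne', Real.rpow_one, Real.div_rpow (by positivity) hr.le,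
      Real.mul_rpow hH0.le ha]
  have e2 : Y ^ p = |H| ^ p * a ^ p / r ^ p * g ^ (p / (p - 1)) := by
    rw [hY, Real.mul_rpow (by positivity) (by positivity), ← Real.rpow_mul hg0.le,
      one_div_mul_eq_div, Real.div_rpow (by positivity) hr.le, Real.mul_rpow hH0.le ha]
  have e3 : r * r ^ (s - p) = r ^ s / r ^ (p - 1) := by
    rw [← Real.rpow_sub hr, mul_comm, ← Real.rpow_add_one hr.ne']
    congr 1; ring
  have e4 : r ^ (s - p) = r ^ s / r ^ p := Real.rpow_sub hr _ _
  have e5 : |H| ^ (p - 2) * |H| = |H| ^ (p - 1) := by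
    rw [← Real.rpow_add_one hH0.ne']; congr 1; ring
  calc -(|H| ^ (p - 2) * H * (r * (r ^ (s - p) * f) * τ))
      ≤ |(|H| ^ (p - 2) * H * (r * (r ^ (s - p) * f) * τ))| := neg_le_abs _
    _ = |H| ^ (p - 1) * (r * r ^ (s - p)) * f * |τ| := by
        rw [abs_mul, abs_mul, abs_mul, abs_of_pos (by positivity : 0 < |H| ^ (p - 2)), e5,
          abs_of_pos (by positivity : 0 < r * (r ^ (s - p) * f))]
        ring
    _ ≤ |H| ^ (p - 1) * (r * r ^ (s - p)) * f * (p * a ^ (p - 1) * b) := by gcongr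
    _ = r ^ s * W * (p * b * Y ^ (p - 1)) := by rw [e1, e3, hfg]; ring
    _ ≤ r ^ s * W * (b ^ p + (p - 1) * Y ^ p) := by
        gcongr
        exact mul_rpow_sub_one_le hp hb hY0
    _ = _ := by rw [e2, e4]; ring

/-! ### The radial profile of the test function -/

theorem contDiffOn_eta (m : ℕ∞) : ContDiffOn ℝ 1 (eta m) (Ioo 0 1) := by
  have h := contDiffOn_succ_iff_deriv_of_isOpen (𝕜 := ℝ) (n := 0) (f := eta m)
    (isOpen_Ioo (a := (0 : ℝ)) (b := 1))
  rw [zero_add] at h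
  refine h.2 ⟨fun t ht => (hasDerivAt_eta m ht).differentiableAt.differentiableWithinAt, by simp, ?_⟩
  rw [contDiffOn_zero]
  refine ContinuousOn.congr (f := fun t => (eta m t ^ 2 + zeta m t) / (2 * t)) ?_
    fun t ht => (hasDerivAt_eta m ht).deriv
  exact (((continuousOn_eta m).pow 2).add (continuousOn_zeta m)).div (by fun_prop)
    fun t ht => by have := ht.1; positivity

/-- The radial profile `r ^ e * (1 + a η + b η ^ 2)` of the test function, with `η` evaluated at `r / D`;
it is used with `e = s - p`. -/
noncomputable def profile (m : ℕ∞) (e a b D r : ℝ) : ℝ :=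
  r ^ e * (1 + a * eta m (r / D) + b * eta m (r / D) ^ 2)

theorem div_mem_Ioo {D r : ℝ} (hr : r ∈ Ioo 0 D) : r / D ∈ Ioo 0 1 := by
  have hD : 0 < D := hr.1.trans hr.2
  exact ⟨div_pos hr.1 hD, (div_lt_one hD).2 hr.2⟩

theorem contDiffOn_profile (m : ℕ∞) (e a b D : ℝ) : ContDiffOn ℝ 1 (profile m e a b D) (Ioo 0 D) := by
  have h1 : ContDiffOn ℝ 1 (fun r => eta m (r / D)) (Ioo 0 D) :=
    (contDiffOn_eta m).comp (contDiffOn_id.div_const D) fun r hr => div_mem_Ioo hr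
  have h2 : ContDiffOn ℝ 1 (fun r : ℝ => r ^ e) (Ioo 0 D) :=
    contDiffOn_id.rpow_const_of_ne fun r hr => hr.1.ne'
  exact h2.mul ((contDiffOn_const.add (contDiffOn_const.mul h1)).add
    (contDiffOn_const.mul (h1.pow 2)))

/-- The identity `t η' = (η ^ 2 + ζ) / 2` turns the derivative of the profile into a polynomial in `η`
and `ζ`. -/
theorem mul_deriv_profile (m : ℕ∞) (e a b : ℝ) {D r : ℝ} (hr : r ∈ Ioo 0 D) :
    r * deriv (profile m e a b D) r = e * profile m e a b D r + r ^ e *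
      (a * (eta m (r / D) ^ 2 + zeta m (r / D)) / 2
        + b * eta m (r / D) * (eta m (r / D) ^ 2 + zeta m (r / D))) := by
  have hD : D ≠ 0 := (hr.1.trans hr.2).ne'
  have hr0 := hr.1.ne'
  have h1 : HasDerivAt (fun r => eta m (r / D))
      ((eta m (r / D) ^ 2 + zeta m (r / D)) / (2 * (r / D)) * (1 / D)) r := by
    have := (hasDerivAt_eta m (div_mem_Ioo hr)).comp r ((hasDerivAt_id' r).div_const D)
    exact this
  have h2 := Real.hasDerivAt_rpow_const (p := e) (Or.inl hr0)
  have h3 : HasDerivAt (profile m e a b D) _ r :=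
    h2.mul (((h1.const_mul a).const_add 1).add ((h1.pow 2).const_mul b))
  rw [h3.deriv, profile, Real.rpow_sub_one hr0]
  simp
  field_simp

/-! ### The function `|u| ^ p` -/

section AbsRpow

variable {N : ℕ} {U : Set (EuclideanSpace ℝ (Fin N))} {u : EuclideanSpace ℝ (Fin N) → ℝ} {p : ℝ}

theorem IsTestFunction.contDiff_abs_rpow (hu : IsTestFunction U u) (hp : 1 < p) :
    ContDiff ℝ 1 fun x => |u x| ^ p :=
  (hu.contDiff.of_le (by simp)).norm_rpow hp

theorem tsupport_abs_rpow_subset (hp : p ≠ 0) : tsupport (fun x => |u x| ^ p) ⊆ tsupport u :=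
  closure_mono fun x hx h => hx (by simp [h, Real.zero_rpow hp])

theorem tsupport_norm_gradient_rpow_subset (hp : p ≠ 0) :
    tsupport (fun x => ‖gradient u x‖ ^ p) ⊆ tsupport u := by
  refine subset_trans (closure_mono (Function.support_subset_iff'.2 fun x hx => ?_))
    (tsupport_fderiv_subset ℝ)
  simp [gradient, Function.notMem_support.1 hx, Real.zero_rpow hp]

theorem abs_fderiv_abs_rpow_le (hp : 1 < p) {x w : EuclideanSpace ℝ (Fin N)}
    (hu : DifferentiableAt ℝ u x) (hw : ‖w‖ ≤ 1) :
    |fderiv ℝ (fun x => |u x| ^ p) x w| ≤ p * |u x| ^ (p - 1) * ‖gradient u x‖ := by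
  have h1 : HasFDerivAt (fun x => |u x| ^ p) _ x :=
    (hasDerivAt_abs_rpow (u x) hp).comp_hasFDerivAt x hu.hasFDerivAt
  have h2 : |p * |u x| ^ (p - 2) * u x| = p * |u x| ^ (p - 1) := by
    rw [abs_mul, abs_mul, abs_of_pos (by linarith : 0 < p), Real.abs_rpow_of_nonneg (abs_nonneg _),
      abs_abs, mul_assoc, ← Real.rpow_add_one' (abs_nonneg _) (by linarith)]
    congr 2; ring
  rw [h1.fderiv, smul_apply, smul_eq_mul, abs_mul, h2, ← inner_gradient_left]
  have h3 : |inner ℝ (gradient u x) w| ≤ ‖gradient u x‖ * 1 :=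
    (abs_real_inner_le_norm _ _).trans (by gcongr)
  have : 0 ≤ p * |u x| ^ (p - 1) := by positivity
  gcongr
  simpa using h3

end AbsRpow

/-! ### The integral inequality -/

theorem linearCombination_integral {X : Type*} [MeasurableSpace X] {μ : Measure X}
    {f₁ f₂ f₃ f₄ : X → ℝ} (h₁ : Integrable f₁ μ) (h₂ : Integrable f₂ μ) (h₃ : Integrable f₃ μ)
    (h₄ : Integrable f₄ μ) {c₁ c₂ c₃ c₄ : ℝ} :
    c₁ * (∫ x, f₁ x ∂μ) + c₂ * (∫ x, f₂ x ∂μ) + c₃ * (∫ x, f₃ x ∂μ) + c₄ * (∫ x, f₄ x ∂μ) =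
      ∫ x, (c₁ * f₁ x + c₂ * f₂ x + c₃ * f₃ x + c₄ * f₄ x) ∂μ := by
  have h12 : Integrable (fun x => c₁ * f₁ x + c₂ * f₂ x) μ :=
    (h₁.const_mul c₁).add (h₂.const_mul c₂)
  have h123 : Integrable (fun x => c₁ * f₁ x + c₂ * f₂ x + c₃ * f₃ x) μ :=
    h12.add (h₃.const_mul c₃)
  rw [integral_add h123 (h₄.const_mul c₄), integral_add h12 (h₃.const_mul c₃),
    integral_add (h₁.const_mul c₁) (h₂.const_mul c₂)]
  simp only [integral_const_mul]

section Hardy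

variable {N : ℕ} {U : Set (EuclideanSpace ℝ (Fin N))} {d u : EuclideanSpace ℝ (Fin N) → ℝ}

theorem integrable_weight_mul {D e : ℝ} (hU : IsOpen U) (hd : Continuous d)
    (hdU : ∀ x ∈ U, d x ∈ Ioo 0 D) {g : ℝ → ℝ} (hg : ContinuousOn g (Ioo 0 1))
    {v : EuclideanSpace ℝ (Fin N) → ℝ} (hv : Continuous v) (hvc : HasCompactSupport v)
    (hvU : tsupport v ⊆ U) :
    Integrable fun x => d x ^ e * g (d x / D) * v x := by
  refine integrable_mul_of_tsupport_subset hU (ContinuousOn.mul ?_ ?_) hv hvc hvU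
  · exact hd.continuousOn.rpow_const fun x hx => Or.inl (hdU x hx).1.ne'
  · exact hg.comp (hd.continuousOn.div_const D) fun x hx => div_mem_Ioo (hdU x hx)

theorem continuousOn_weight (m : ℕ∞) (α β γ : ℝ) : ContinuousOn (weight m α β γ) (Ioo 0 1) :=
  ((continuousOn_const.add (continuousOn_const.mul (continuousOn_eta m))).add
    (continuousOn_const.mul ((continuousOn_eta m).pow 2))).add
    (continuousOn_const.mul (continuousOn_zeta m))

theorem IsTestFunction.integrable_weight_abs {D e p : ℝ} (hu : IsTestFunction U u) (hp : 1 < p)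
    (hU : IsOpen U) (hd : Continuous d) (hdU : ∀ x ∈ U, d x ∈ Ioo 0 D) {g : ℝ → ℝ}
    (hg : ContinuousOn g (Ioo 0 1)) :
    Integrable fun x => d x ^ e * g (d x / D) * |u x| ^ p := by
  have hs : tsupport (fun x => |u x| ^ p) ⊆ tsupport u := tsupport_abs_rpow_subset (by linarith)
  exact integrable_weight_mul hU hd hdU hg (hu.contDiff_abs_rpow hp).continuous
    (hu.hasCompactSupport.of_isClosed_subset (isClosed_tsupport _) hs) (hs.trans hu.tsupport_subset)

theorem IsTestFunction.integrable_weight_norm_gradient {D e p : ℝ} (hu : IsTestFunction U u)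
    (hp : 1 < p) (hU : IsOpen U) (hd : Continuous d) (hdU : ∀ x ∈ U, d x ∈ Ioo 0 D) {g : ℝ → ℝ}
    (hg : ContinuousOn g (Ioo 0 1)) :
    Integrable fun x => d x ^ e * g (d x / D) * ‖gradient u x‖ ^ p := by
  have hs : tsupport (fun x => ‖gradient u x‖ ^ p) ⊆ tsupport u :=
    tsupport_norm_gradient_rpow_subset (by linarith)
  have hc : Continuous (gradient u) :=
    (InnerProductSpace.toDual ℝ _).symm.continuous.comp (hu.contDiff.continuous_fderiv (by simp))
  exact integrable_weight_mul hU hd hdU hg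
    (hc.norm.rpow_const fun _ => Or.inr (by linarith : (0 : ℝ) ≤ p))
    (hu.hasCompactSupport.of_isClosed_subset (isClosed_tsupport _) hs) (hs.trans hu.tsupport_subset)

/-- The inequality with the lower-order terms still under one integral sign. The hypothesis `hpt` is the
conclusion of `exists_pointwise_ineq` at the values taken by `η` and `ζ`. -/
theorem integral_weighted_hardy {p s k H α β γ κ b D : ℝ} {m : ℕ∞} (hp : 1 < p)
    (hH0 : H ≠ 0) (hH : k + s - p = p * H) (hU : IsOpen U) (hd : LipschitzWith 1 d)
    (hgrad : ∀ᵐ x, x ∈ U → ‖gradient d x‖ = 1) (hdU : ∀ x ∈ U, d x ∈ Ioo 0 D)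
    (hineq : DistribIneq U d (k + s - p) k) (hu : IsTestFunction U u)
    (hpt : ∀ x ∈ U, ∀ y z W f : ℝ, y = eta m (d x / D) → z = zeta m (d x / D) →
      W = 1 + α * y + β * y ^ 2 + γ * z → f = 1 + (α + κ) * y + b * y ^ 2 →
      0 < W ∧ 0 < f ∧
      W + α / (2 * H) * (y ^ 2 + z) + κ / (2 * H) * z ≤
        p * f - (p - 1) * W * (f / W) ^ (p / (p - 1)) +
          1 / H * ((α + κ) * (y ^ 2 + z) / 2 + b * y * (y ^ 2 + z))) :
    ∫ x in U, d x ^ (s - p) * (|H| ^ p * (weight m α β γ (d x / D) +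
        α / (2 * H) * (eta m (d x / D) ^ 2 + zeta m (d x / D)) +
        κ / (2 * H) * zeta m (d x / D))) * |u x| ^ p ≤
      ∫ x in U, d x ^ s * weight m α β γ (d x / D) * ‖gradient u x‖ ^ p := by
  have hp0 : p ≠ 0 := by linarith
  have hHp : 0 < |H| := abs_pos.2 hH0
  have hv := hu.contDiff_abs_rpow hp
  have hvs : tsupport (fun x => |u x| ^ p) ⊆ tsupport u := tsupport_abs_rpow_subset hp0
  have hvc : HasCompactSupport fun x => |u x| ^ p :=
    hu.hasCompactSupport.of_isClosed_subset (isClosed_tsupport _) hvs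
  set G := profile m (s - p) (α + κ) b D with hG
  have hG0 : ∀ x ∈ U, 0 ≤ G (d x) := fun x hx => by
    have h1 := (hpt x hx _ _ _ _ rfl rfl rfl rfl).2.1
    exact mul_nonneg (Real.rpow_nonneg (hdU x hx).1.le _) h1.le
  obtain ⟨hAi, hA⟩ := hineq.integral_comp_mul hU hd hgrad isOpen_Ioo hdU
    (contDiffOn_profile m (s - p) (α + κ) b D) hG0 hv (fun x => by positivity) hvc
    (hvs.trans hu.tsupport_subset)
  rw [← hG] at hAi hA
  -- The tested inequality says `H ∫ A ≤ 0`; it remains to compare the integrands.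
  set A := fun x => (k * G (d x) + d x * deriv G (d x)) * |u x| ^ p
    + d x * G (d x) * fderiv ℝ (fun x => |u x| ^ p) x (gradient d x) with hAdef
  have hA' : |H| ^ (p - 2) * H * (∫ x in U, A x) ≤ 0 := by
    rw [hH, mul_assoc] at hA
    have h1 : H * (∫ x in U, A x) ≤ 0 := by
      by_contra! h
      exact absurd hA (not_le.2 (mul_pos (by linarith) h))
    rw [mul_assoc]
    exact mul_nonpos_of_nonneg_of_nonpos (by positivity) h1
  have hI0 := hu.integrable_weight_abs (e := s - p) (D := D) (p := p) hp hU hd.continuous hdU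
    (g := fun t => |H| ^ p * (weight m α β γ t + α / (2 * H) * (eta m t ^ 2 + zeta m t)
      + κ / (2 * H) * zeta m t))
    (continuousOn_const.mul (((continuousOn_weight m α β γ).add (continuousOn_const.mul
      (((continuousOn_eta m).pow 2).add (continuousOn_zeta m)))).add
      (continuousOn_const.mul (continuousOn_zeta m))))
  have hI1 := hu.integrable_weight_norm_gradient (e := s) (D := D) (p := p) hp hU hd.continuous hdU
    (continuousOn_weight m α β γ)
  have hle : ∫ x in U, d x ^ (s - p) * (|H| ^ p * (weight m α β γ (d x / D) +
        α / (2 * H) * (eta m (d x / D) ^ 2 + zeta m (d x / D)) +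
        κ / (2 * H) * zeta m (d x / D))) * |u x| ^ p ≤
      ∫ x in U, (d x ^ s * weight m α β γ (d x / D) * ‖gradient u x‖ ^ p
        + |H| ^ (p - 2) * H * A x) := by
    refine integral_mono_ae hI0.integrableOn
      (hI1.integrableOn.add (hAi.const_mul (|H| ^ (p - 2) * H))) ?_
    filter_upwards [ae_restrict_mem hU.measurableSet, ae_restrict_of_ae hgrad] with x hx h1
    have hr := hdU x hx
    obtain ⟨hW, hf, hmain⟩ := hpt x hx _ _ _ _ rfl rfl rfl rfl
    have hτ := abs_fderiv_abs_rpow_le (w := gradient d x) hp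
      (hu.contDiff.differentiable (by simp) x) (h1 hx).le
    have hy := young_pointwise (s := s) hp hH0 hr.1 hW hf (abs_nonneg (u x))
      (norm_nonneg (gradient u x)) hτ
    have hG' := mul_deriv_profile m (s - p) (α + κ) b hr
    have hσ : |H| ^ (p - 2) * H = |H| ^ p / H := by
      rw [eq_div_iff hH0, mul_assoc, ← sq, ← sq_abs H, ← Real.rpow_natCast |H| 2,
        ← Real.rpow_add hHp]
      norm_num
    have hpos : 0 ≤ |H| ^ p * d x ^ (s - p) * |u x| ^ p := by
      have := hr.1
      positivity
    have hm := mul_le_mul_of_nonneg_left hmain hpos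
    rw [hσ] at hy ⊢
    simp only [hAdef]
    rw [← hG] at hG'
    rw [hG']
    have hGd : G (d x) = d x ^ (s - p) * (1 + (α + κ) * eta m (d x / D)
      + b * eta m (d x / D) ^ 2) := rfl
    rw [hGd]
    simp only [weight]
    generalize eta m (d x / D) = y at *
    generalize zeta m (d x / D) = z at *
    generalize 1 + α * y + β * y ^ 2 + γ * z = W at *
    generalize 1 + (α + κ) * y + b * y ^ 2 = f at *
    generalize fderiv ℝ (fun x => |u x| ^ p) x (gradient d x) = τ at *
    have hk : k = p * H - s + p := by linarith
    have e : |H| ^ p / H * ((k * (d x ^ (s - p) * f) + ((s - p) * (d x ^ (s - p) * f) + d x ^ (s - p) *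
        ((α + κ) * (y ^ 2 + z) / 2 + b * y * (y ^ 2 + z)))) * |u x| ^ p
        + d x * (d x ^ (s - p) * f) * τ) =
        |H| ^ p * d x ^ (s - p) * |u x| ^ p * (p * f + 1 / H *
          ((α + κ) * (y ^ 2 + z) / 2 + b * y * (y ^ 2 + z))) +
        |H| ^ p / H * (d x * (d x ^ (s - p) * f) * τ) := by
      rw [hk]; field_simp; ring
    rw [e]
    linarith
  refine hle.trans ?_
  rw [integral_add hI1.integrableOn (hAi.const_mul _), integral_const_mul]
  linarith

end Hardy

end WeightedHardy

theorem theorem1 (N : ℕ) (hN : 2 ≤ N) (p s k : ℝ) (hp : 1 < p) (hpks : p ≠ k + s)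
    (m : ℕ∞) (hm : 1 ≤ m)
    (Ω K : Set (EuclideanSpace ℝ (Fin N)))
    (hΩ_open : IsOpen Ω) (hΩ_conn : IsConnected Ω)
    (hK_closed : IsClosed K) (hK_ne : K.Nonempty)
    (d : EuclideanSpace ℝ (Fin N) → ℝ) (hd : d = fun x => Metric.infDist x K)
    (hd_bdd : BddAbove (d '' Ω))
    (hineq : WeightedHardy.DistribIneq (Ω \ K) d (k + s - p) k)
    (H : ℝ) (hH : H = (k + s - p) / p)
    (α β γ : ℝ) :
    ∃ D₀ : ℝ, 0 < D₀ ∧ sSup (d '' Ω) ≤ D₀ ∧ ∀ D : ℝ, D₀ ≤ D →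
      -- both series converge and the weight is positive
      (∀ x ∈ Ω \ K,
        Summable (fun i : ℕ => WeightedHardy.prodX (i + 1) (d x / D)) ∧
        Summable (fun i : ℕ => WeightedHardy.prodX (i + 1) (d x / D) ^ 2) ∧
        0 < WeightedHardy.weight m α β γ (d x / D)) ∧
      ∀ u : EuclideanSpace ℝ (Fin N) → ℝ, WeightedHardy.IsTestFunction (Ω \ K) u →
        -- all five integrals converge
        IntegrableOn (fun x => d x ^ s * WeightedHardy.weight m α β γ (d x / D) *
          ‖gradient u x‖ ^ p) Ω ∧
        IntegrableOn (fun x => d x ^ (s - p) * |u x| ^ p) Ω ∧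
        IntegrableOn (fun x => d x ^ (s - p) * WeightedHardy.eta m (d x / D) * |u x| ^ p) Ω ∧
        IntegrableOn (fun x => d x ^ (s - p) * WeightedHardy.eta m (d x / D) ^ 2 * |u x| ^ p) Ω ∧
        IntegrableOn (fun x => d x ^ (s - p) * WeightedHardy.zeta m (d x / D) * |u x| ^ p) Ω ∧
        -- the weighted improved Hardy inequality
        |H| ^ p * (∫ x in Ω, d x ^ (s - p) * |u x| ^ p)
          + |H| ^ p * α * (∫ x in Ω, d x ^ (s - p) * WeightedHardy.eta m (d x / D) * |u x| ^ p)
          + (|H| ^ p * β + |H| ^ (p - 2) * H * α / 2) *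
            (∫ x in Ω, d x ^ (s - p) * WeightedHardy.eta m (d x / D) ^ 2 * |u x| ^ p)
          + ((p - 1) / (2 * p) * |H| ^ (p - 2) + |H| ^ (p - 2) * H * α / 2 + |H| ^ p * γ) *
            (∫ x in Ω, d x ^ (s - p) * WeightedHardy.zeta m (d x / D) * |u x| ^ p)
        ≤ ∫ x in Ω, d x ^ s * WeightedHardy.weight m α β γ (d x / D) * ‖gradient u x‖ ^ p := by

  have hp0 : 0 < p := by linarith
  have hH0 : H ≠ 0 := by
    rw [hH]
    exact div_ne_zero (fun h => hpks (by linarith)) hp0.ne'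
  have hpH : k + s - p = p * H := by rw [hH]; field_simp
  have hU : IsOpen (Ω \ K) := hΩ_open.sdiff hK_closed
  have hd1 : LipschitzWith 1 d := by rw [hd]; exact Metric.lipschitz_infDist_pt K
  have hgrad : ∀ᵐ x, x ∈ Ω \ K → ‖gradient d x‖ = 1 := by
    filter_upwards [hd1.ae_differentiableAt] with x hx hxU
    subst hd
    exact WeightedHardy.norm_gradient_infDist hK_closed hK_ne hxU.2 hx
  have hdpos : ∀ x ∈ Ω \ K, 0 < d x := fun x hx => by
    rw [hd]
    exact (hK_closed.notMem_iff_infDist_pos hK_ne).1 hx.2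
  have hdS : ∀ x ∈ Ω \ K, d x ≤ sSup (d '' Ω) := fun x hx => le_csSup hd_bdd ⟨x, hx.1, rfl⟩
  have hS : 0 ≤ sSup (d '' Ω) := Real.sSup_nonneg fun r ⟨x, _, hx⟩ => by
    rw [← hx, hd]; exact Metric.infDist_nonneg
  -- `D₀` is chosen so that `d / D ≤ τ` on `Ω \ K`, where `η ≤ ε` for every `m`.
  obtain ⟨b, ε, hε, hpt⟩ := WeightedHardy.exists_pointwise_ineq hp hH0 α β γ
  obtain ⟨τ, hτ, hητ⟩ := WeightedHardy.exists_eta_le hε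
  have hτ1 : τ < 1 := hτ.2.trans_lt (Real.exp_lt_one_iff.2 (by norm_num))
  refine ⟨(sSup (d '' Ω) + 1) / τ, by have := hτ.1; positivity, ?_, fun D hD => ?_⟩
  · rw [le_div_iff₀ hτ.1]
    nlinarith
  have hSD : sSup (d '' Ω) + 1 ≤ τ * D := by
    rw [div_le_iff₀ hτ.1] at hD
    linarith
  have hD0 : 0 < D := pos_of_mul_pos_right (by linarith) hτ.1.le
  have hdτ : ∀ x ∈ Ω \ K, d x / D ∈ Set.Ioc 0 τ := fun x hx =>
    ⟨div_pos (hdpos x hx) hD0, by rw [div_le_iff₀ hD0]; linarith [hdS x hx]⟩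
  have hdD : ∀ x ∈ Ω \ K, d x ∈ Set.Ioo 0 D := fun x hx =>
    ⟨hdpos x hx, by nlinarith [hdS x hx]⟩
  have hpt' : ∀ x ∈ Ω \ K, ∀ y z W f : ℝ, y = WeightedHardy.eta m (d x / D) →
      z = WeightedHardy.zeta m (d x / D) →
      W = 1 + α * y + β * y ^ 2 + γ * z → f = 1 + (α + (p - 1) / (p * H)) * y + b * y ^ 2 →
      0 < W ∧ 0 < f ∧
      W + α / (2 * H) * (y ^ 2 + z) + (p - 1) / (p * H) / (2 * H) * z ≤
        p * f - (p - 1) * W * (f / W) ^ (p / (p - 1)) +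
          1 / H * ((α + (p - 1) / (p * H)) * (y ^ 2 + z) / 2 + b * y * (y ^ 2 + z)) := by
    intro x hx y z W f hy hz hW hf
    have ht := WeightedHardy.div_mem_Ioo (hdD x hx)
    refine hpt y z W f ?_ ?_ ?_ ?_ hW hf
    · rw [hy]; exact WeightedHardy.eta_pos hm ht
    · rw [hy]; exact hητ m _ (hdτ x hx)
    · rw [hy, hz]
      exact WeightedHardy.eta_sq_le_zeta hm ⟨ht.1, (hdτ x hx).2.trans hτ.2⟩
    · rw [hy, hz]; exact WeightedHardy.zeta_le_eta_sq m ht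
  refine ⟨fun x hx => ?_, fun u hu => ?_⟩
  · have ht := WeightedHardy.div_mem_Ioo (hdD x hx)
    exact ⟨WeightedHardy.summable_prodX ht, WeightedHardy.summable_prodX_sq ht,
      (hpt' x hx _ _ _ _ rfl rfl rfl rfl).1⟩
  have hη := WeightedHardy.continuousOn_eta m
  have hζ := WeightedHardy.continuousOn_zeta m
  have hw := WeightedHardy.continuousOn_weight m α β γ
  have i1 := hu.integrable_weight_norm_gradient (e := s) hp hU hd1.continuous hdD hw
  have i2 := hu.integrable_weight_abs (e := s - p) hp hU hd1.continuous hdD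
    (continuousOn_const (c := (1 : ℝ)))
  have i3 := hu.integrable_weight_abs (e := s - p) hp hU hd1.continuous hdD hη
  have i4 := hu.integrable_weight_abs (e := s - p) hp hU hd1.continuous hdD
    (g := fun t => WeightedHardy.eta m t ^ 2) (hη.pow 2)
  have i5 := hu.integrable_weight_abs (e := s - p) hp hU hd1.continuous hdD hζ
  simp only [mul_one] at i2
  refine ⟨i1.integrableOn, i2.integrableOn, i3.integrableOn, i4.integrableOn, i5.integrableOn, ?_⟩
  have main := WeightedHardy.integral_weighted_hardy hp hH0 hpH hU hd1 hgrad hdD hineq hu hpt'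
  have hu0 : ∀ x ∉ Ω \ K, u x = 0 ∧ gradient u x = 0 := fun x hx =>
    ⟨image_eq_zero_of_notMem_tsupport fun h => hx (hu.tsupport_subset h), by
      rw [gradient, image_eq_zero_of_notMem_tsupport fun h =>
        hx (hu.tsupport_subset (tsupport_fderiv_subset ℝ h)), map_zero]⟩
  have hΩU : ∀ {g v : EuclideanSpace ℝ (Fin N) → ℝ}, (∀ x ∉ Ω \ K, v x = 0) →
      ∫ x in Ω \ K, g x * v x = ∫ x in Ω, g x * v x := fun {g v} hv =>
    (setIntegral_eq_of_subset_of_forall_sdiff_eq_zero hΩ_open.measurableSet Set.sdiff_subset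
      fun x hx => by rw [hv x hx.2, mul_zero]).symm
  -- Both integrands vanish on `Ω ∩ K`, so that integrating over `Ω` or `Ω \ K` is the same.
  rw [hΩU fun x hx => by rw [(hu0 x hx).1, abs_zero, Real.zero_rpow hp0.ne'],
    hΩU fun x hx => by rw [(hu0 x hx).2, norm_zero, Real.zero_rpow hp0.ne']] at main
  refine le_trans (le_of_eq ?_) main
  have hH2 : |H| ^ p = |H| ^ (p - 2) * H ^ 2 := by
    rw [← sq_abs H, ← Real.rpow_natCast |H| 2, ← Real.rpow_add (abs_pos.2 hH0)]
    norm_num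
  rw [WeightedHardy.linearCombination_integral i2.integrableOn i3.integrableOn i4.integrableOn
    i5.integrableOn]
  refine integral_congr_ae (.of_forall fun x => ?_)
  simp only [WeightedHardy.weight, hH2]
  field_simp
  ring
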